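/- Let $m\ge 1$, let $\Gamma$ be a cyclic group of order $m$ with a primitive (faithful) character $\epsilon$, let $L=\epsilon\oplus\epsilon^{-1}$, and let $W_i$ $(i\in\mathbb Z/m)$ be the one-dimensional $\Gamma$-module with character $\epsilon^i$. Let $V\cong\bigoplus_{i\in\mathbb Z/m}V_i\otimes W_i$ be a finite-dimensional complex $\Gamma$-module, $k_i=\dim_{\mathbb C}V_i$, and let $n\in\mathbb Z/m$. Let $\mathfrak M^{1}_\Gamma(V,W_n)$ be the Nakajima variety for the parameter $\tau=1$, i.e. the GIT quotient, by the group of $\Gamma$-equivariant automorphisms of $V$, of the space of quadruples $(\bar X,\bar Y,\bar i,\bar j)\in \mathrm{End}(V)^{2}\oplus\mathrm{Hom}_\Gamma(W_n,V)\oplus\mathrm{Hom}_\Gamma(V,W_n)$ such that, writing $\bar G$ for the action of $g\in\Gamma$ on $V$, $$\bar X\bar G=\epsilon(g)\bar G\bar X,\qquad \bar Y\bar G=\epsilon^{-1}(g)\bar G\bar Y\quad(g\in\Gamma),\qquad \bar X\bar Y-\bar Y\bar X+\mathrm{Id}=\bar i\,\bar j,$$ and such that no proper $\Gamma$-submodule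 of $V$ is stable under $\bar X,\bar Y$ and contains the image of $\bar i$. Let $D^n_{(k_0,\dots,k_{m-1})}$ be the GIT quotient by $\prod_i GL(V_i)$ of the space of tuples $(\bar X_i:V_{i+1}\to V_i,\ \bar Y_i:V_i\to V_{i+1}\ (i\in\mathbb Z/m),\ \bar i_n:\mathbb C\to V_n,\ \bar j_n:V_n\to\mathbb C)$ with $$\bar X_i\bar Y_i-\bar Y_{i-1}\bar X_{i-1}+\mathrm{Id}=0\ (i\ne n),\qquad \bar X_n\bar Y_n-\bar Y_{n-1}\bar X_{n-1}+\mathrm{Id}=\bar i_n\bar j_n .$$ Then the map $\psi:\mathfrak M^{1}_\Gamma(V,W_n)\to D^n_{(k_0,\dots,k_{m-1})}$ that sends a quadruple to its blocks $\bar X_i=\bar X|_{V_{i+1}}$, $\bar Y_i=\bar Y|_{V_i}$, $\bar i_n$, $\bar j_n$ is well defined and is an isomorphism of algebraic varieties. Its inverse sends $(\bar X_i,\bar Y_i,\bar i_n,\bar j_n)$ to the class of $(\bar X,\bar Y,\bar i,\bar j)$, where $\bar X$ is the block-cyclic matrix with block $\bar X_i$ in row $i$ and column $i+1$, $\bar Y$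 is the block-cyclic matrix with block $\bar Y_i$ in row $i+1$ and column $i$ (all other blocks are $0$), and $\bar i$, $\bar j$ are $\bar i_n$, $\bar j_n$ extended by $0$. Moreover, whenever $D^n_{(k_0,\dots,k_{m-1})}$ is non-empty, $$\dim_{\mathbb C}D^n_{(k_0,k_1)}=2\bigl(k_n-(k_0-k_1)^2\bigr)\quad\text{for } m=2,$$ $$\dim_{\mathbb C}D^n_{(k_0,\dots,k_{m-1})}=2\Bigl(k_n-\Bigl(\sum_{i\in\mathbb Z/m}k_i^2-\sum_{i\in\mathbb Z/m}k_ik_{i+1}\Bigr)\Bigr)\quad\text{for } m>2 .$$ -/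

import Mathlib

noncomputable section

/-! ### Classical varieties: Zariski topology, regular functions, GIT quotients -/

section Varieties

variable {E : Type*} [AddCommGroup E] [Module ℂ E]

/-- Polynomial functions on a complex vector space: the algebra of functions generated by
the linear functionals. -/
def polyFun (E : Type*) [AddCommGroup E] [Module ℂ E] : Subalgebra ℂ (E → ℂ) :=
  Algebra.adjoin ℂ (Set.range fun φ : Module.Dual ℂ E => (φ : E → ℂ))

/-- The Zariski topology on a subset `Z` of a vector space, with basic open sets `p ≠ 0`. -/
@[reducible] def zariski (Z : Set E) : TopologicalSpace Z :=
  TopologicalSpace.generateFrom {s | ∃ p ∈ polyFun E, s = {x : Z | p x ≠ 0}}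

/-- `f` is regular on `O ⊆ Z`: near every point of `O` it is a quotient of polynomials. -/
def IsRegularOn (Z : Set E) (O : Set Z) (f : Z → ℂ) : Prop :=
  ∀ x ∈ O, ∃ p ∈ polyFun E, ∃ q ∈ polyFun E,
    q x ≠ 0 ∧ ∀ y ∈ O, q y ≠ 0 → f y = p y / q y

/-- `f : Z → ℂ` is constant along the orbits of the action `act` of `G`. -/
def IsInvariantFun {G : Type*} (act : G → E → E) (Z : Set E) (f : Z → ℂ) : Prop :=
  ∀ (g : G) (x y : Z), (y : E) = act g x → f y = f x

/-- Two points of `Z` have the same image in the GIT quotient iff no invariant regular function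
on `Z` separates them. -/
def gitSetoid {G : Type*} (act : G → E → E) (Z : Set E) : Setoid Z where
  r x y := ∀ f : Z → ℂ, IsRegularOn Z Set.univ f → IsInvariantFun act Z f → f x = f y
  iseqv :=
    ⟨fun _ _ _ _ => rfl, fun h f h₁ h₂ => (h f h₁ h₂).symm,
      fun h h' f h₁ h₂ => (h f h₁ h₂).trans (h' f h₁ h₂)⟩

/-- The GIT quotient `Z // G`. -/
def GITQuotient {G : Type*} (act : G → E → E) (Z : Set E) : Type _ :=
  Quotient (gitSetoid act Z)

/-- The quotient map `Z → Z // G`. -/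
def GITQuotient.mk {G : Type*} (act : G → E → E) (Z : Set E) (x : Z) : GITQuotient act Z :=
  Quotient.mk (gitSetoid act Z) x

/-- A set in `Z // G` is open iff its preimage in `Z` is Zariski open. -/
instance {G : Type*} (act : G → E → E) (Z : Set E) : TopologicalSpace (GITQuotient act Z) :=
  (zariski Z).coinduced (GITQuotient.mk act Z)

/-- A function on an open subset of `Z // G` is regular iff its pull-back to `Z` is. -/
def GITQuotient.IsRegularOn {G : Type*} {act : G → E → E} {Z : Set E}
    (O : Set (GITQuotient act Z)) (f : GITQuotient act Z → ℂ) : Prop :=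
  _root_.IsRegularOn Z (GITQuotient.mk act Z ⁻¹' O) (f ∘ GITQuotient.mk act Z)

/-- Isomorphism of varieties: a homeomorphism under which the regular functions on
corresponding open sets correspond. -/
def IsVarietyIso {E' : Type*} [AddCommGroup E'] [Module ℂ E'] {G G' : Type*}
    {act : G → E → E} {Z : Set E} {act' : G' → E' → E'} {Z' : Set E'}
    (ψ : GITQuotient act Z → GITQuotient act' Z') : Prop :=
  IsHomeomorph ψ ∧
    ∀ (O : Set (GITQuotient act' Z')) (f : GITQuotient act' Z' → ℂ), IsOpen O →
      (GITQuotient.IsRegularOn O f ↔ GITQuotient.IsRegularOn (ψ ⁻¹' O) (f ∘ ψ))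

end Varieties

/-! ### Nakajima varieties of a cyclic group -/

section Nakajima

/-- Quadruples `(X, Y, i, j)`. -/
abbrev Quad (U W : Type*) [AddCommGroup U] [Module ℂ U] [AddCommGroup W] [Module ℂ W] : Type _ :=
  (U →ₗ[ℂ] U) × (U →ₗ[ℂ] U) × (W →ₗ[ℂ] U) × (U →ₗ[ℂ] W)

variable {Γ : Type*} [Group Γ]
  {U : Type*} [AddCommGroup U] [Module ℂ U] {W : Type*} [AddCommGroup W] [Module ℂ W]

/-- The space of stable `Γ`-equivariant quadruples satisfying the moment map equation, for the
symplectic representation `L = ε ⊕ ε⁻¹` of `Γ` and the parameter `τ` in the group algebra. A map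
`B : U → U ⊗ L` is written as `B v = X v ⊗ ε + Y v ⊗ ε⁻¹`. -/
def nakajimaSet (ε : Γ →* ℂˣ) (ρ : Representation ℂ Γ U) (σ : Representation ℂ Γ W)
    (τ : MonoidAlgebra ℂ Γ) : Set (Quad U W) :=
  {q | match q with
    | (X, Y, i, j) =>
      -- `B`, `i`, `j` are `Γ`-equivariant
      (∀ g, X ∘ₗ ρ g = (ε g : ℂ) • (ρ g ∘ₗ X)) ∧
      (∀ g, Y ∘ₗ ρ g = ((ε g)⁻¹ : ℂ) • (ρ g ∘ₗ Y)) ∧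
      (∀ g, i ∘ₗ σ g = ρ g ∘ₗ i) ∧
      (∀ g, j ∘ₗ ρ g = σ g ∘ₗ j) ∧
      -- the moment map equation
      X ∘ₗ Y - Y ∘ₗ X + ρ.asAlgebraHom τ = i ∘ₗ j ∧
      -- no proper `B`-stable submodule contains the image of `i`
      (∀ U' : Submodule ℂ U, (∀ g, ∀ u ∈ U', ρ g u ∈ U') → (∀ u ∈ U', X u ∈ U') →
        (∀ u ∈ U', Y u ∈ U') → (∀ w, i w ∈ U') → U' = ⊤)}

/-- The group of `Γ`-equivariant automorphisms of `U`. -/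
abbrev EquivariantAut (ρ : Representation ℂ Γ U) : Type _ :=
  {a : U ≃ₗ[ℂ] U // ∀ g u, a (ρ g u) = ρ g (a u)}

/-- The action `a • (X, Y, i, j) = (a X a⁻¹, a Y a⁻¹, a i, j a⁻¹)`. -/
def nakajimaAct (ρ : Representation ℂ Γ U) (a : EquivariantAut ρ) (q : Quad U W) : Quad U W :=
  match q with
  | (X, Y, i, j) =>
    (a.1.toLinearMap ∘ₗ X ∘ₗ a.1.symm.toLinearMap, a.1.toLinearMap ∘ₗ Y ∘ₗ a.1.symm.toLinearMap,
      a.1.toLinearMap ∘ₗ i, j ∘ₗ a.1.symm.toLinearMap)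

/-- The Nakajima variety `𝔐^τ_Γ(U, W)`. -/
abbrev NakajimaVariety (ε : Γ →* ℂˣ) (ρ : Representation ℂ Γ U) (σ : Representation ℂ Γ W)
    (τ : MonoidAlgebra ℂ Γ) : Type _ :=
  GITQuotient (nakajimaAct ρ) (nakajimaSet ε ρ σ τ)

/-- The one-dimensional representation with character `χ`. -/
def charRep (χ : Γ →* ℂˣ) : Representation ℂ Γ ℂ :=
  (algebraMap ℂ (Module.End ℂ ℂ)).toMonoidHom.comp ((Units.coeHom ℂ).comp χ)

end Nakajima

/-! ### The cyclic quiver variety -/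

section CyclicQuiver

variable {m : ℕ} (V : ZMod m → Type*) [∀ i, AddCommGroup (V i)] [∀ i, Module ℂ (V i)]

/-- Tuples `(X₀, …, X_{m-1}; Y₀, …, Y_{m-1}, i_n, j_n)` with indices modulo `m`. -/
abbrev CyclicQuad (n : ZMod m) : Type _ :=
  (∀ i, V (i + 1) →ₗ[ℂ] V i) × (∀ i, V i →ₗ[ℂ] V (i + 1)) × (ℂ →ₗ[ℂ] V n) × (V n →ₗ[ℂ] ℂ)

/-- The equations `X_l Y_l - Y_{l-1} X_{l-1} + Id = δ_{l,n} i_n j_n`, written for `l = i + 1`. -/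
def cyclicSet (n : ZMod m) : Set (CyclicQuad V n) :=
  {q | match q with
    | (X, Y, u, v) =>
      ∀ i : ZMod m, X (i + 1) ∘ₗ Y (i + 1) - Y i ∘ₗ X i + LinearMap.id
        = (Pi.single n (u ∘ₗ v) : ∀ l, V l →ₗ[ℂ] V l) (i + 1)}

variable {V}

/-- The action of `∏ GL(V_i)`. -/
def cyclicAct {n : ZMod m} (a : ∀ i, V i ≃ₗ[ℂ] V i) (q : CyclicQuad V n) : CyclicQuad V n :=
  match q with
  | (X, Y, u, v) =>
    (fun i => (a i).toLinearMap ∘ₗ X i ∘ₗ (a (i + 1)).symm.toLinearMap,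
      fun i => (a (i + 1)).toLinearMap ∘ₗ Y i ∘ₗ (a i).symm.toLinearMap,
      (a n).toLinearMap ∘ₗ u, v ∘ₗ (a n).symm.toLinearMap)

variable (V) in
/-- The cyclic quiver variety `D^n`, for the spaces `V_i` of dimension `k_i`. -/
abbrev CyclicQuiverVariety (n : ZMod m) : Type _ :=
  GITQuotient (cyclicAct (V := V) (n := n)) (cyclicSet V n)

variable {U : Type*} [AddCommGroup U] [Module ℂ U]

/-- The blocks `X_i : V_{i+1} → V_i`, `Y_i : V_i → V_{i+1}`, `i_n`, `j_n` of a quadruple with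
respect to a decomposition `Φ` of `U` into the direct sum of the `V_i`. -/
def blocks (Φ : U ≃ₗ[ℂ] ∀ i, V i) (n : ZMod m) (q : Quad U ℂ) : CyclicQuad V n :=
  match q with
  | (X, Y, i, j) =>
    (fun l => LinearMap.proj l ∘ₗ Φ.toLinearMap ∘ₗ X ∘ₗ Φ.symm.toLinearMap ∘ₗ
        LinearMap.single ℂ V (l + 1),
      fun l => LinearMap.proj (l + 1) ∘ₗ Φ.toLinearMap ∘ₗ Y ∘ₗ Φ.symm.toLinearMap ∘ₗ
        LinearMap.single ℂ V l,
      LinearMap.proj n ∘ₗ Φ.toLinearMap ∘ₗ i,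
      j ∘ₗ Φ.symm.toLinearMap ∘ₗ LinearMap.single ℂ V n)

/-- The block-cyclic matrices: `X` has the block `X_l` in row `l` and column `l + 1`, `Y` has the
block `Y_l` in row `l + 1` and column `l`, and all other blocks are `0`. -/
def blockCyclic [NeZero m] (Φ : U ≃ₗ[ℂ] ∀ i, V i) (n : ZMod m) (q : CyclicQuad V n) : Quad U ℂ :=
  match q with
  | (X, Y, u, v) =>
    (Φ.symm.toLinearMap ∘ₗ
        (∑ l, LinearMap.single ℂ V l ∘ₗ X l ∘ₗ LinearMap.proj (l + 1)) ∘ₗ Φ.toLinearMap,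
      Φ.symm.toLinearMap ∘ₗ
        (∑ l, LinearMap.single ℂ V (l + 1) ∘ₗ Y l ∘ₗ LinearMap.proj l) ∘ₗ Φ.toLinearMap,
      Φ.symm.toLinearMap ∘ₗ LinearMap.single ℂ V n ∘ₗ u,
      v ∘ₗ LinearMap.proj n ∘ₗ Φ.toLinearMap)

end CyclicQuiver

end

/-! Everything rests on one trace argument: if `A * B - B * A + 1 = 0` on a finite-dimensional
complex space, taking traces shows that the space is zero. When `X Y - Y X + 1 = i j`, apply this to
the quotient by a stable subspace containing the image of `i`, and to a stable subspace killed by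
`j`: the first subspace is everything, the second is zero (`eq_top_of_commutator`,
`eq_bot_of_commutator`). So the stability condition is automatic, `i` generates and `j` cogenerates.

For the isomorphism, `ε` is faithful, so the weights `ε ^ i` are distinct. Equivariance then forces
`X` to lower the weight by one, `Y` to raise it, and `i`, `j` to involve only weight `n`. Hence
`blocks` and `blockCyclic` are mutually inverse linear maps between the two solution sets. They
carry orbits to orbits, so they exchange invariant functions and descend to the quotients
(`exists_isVarietyIso`).

For the dimension, the quotient is shown to be an orbit space with smooth affine charts. The
polynomial invariants `j p(X, Y) i`, with `p` in the path algebra, separate orbits, because `i`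
generates and `j` cogenerates (`exists_eq_cyclicAct`). Choose for each vertex words `p` whose values
`p i` form a basis at a given point. The locus where they form the standard basis is a slice: it
meets each orbit at most once and maps to the quotient by an open embedding
(`isOpenEmbedding_sliceToQuotient`).

A slice is cut out by the moment map and the frame condition, each with `∑ k_i ^ 2` equations. The
moment map is submersive on its zero set, because a covector killing its derivative commutes with
`X`, `Y` and kills `i`, hence vanishes (`exists_momentDeriv_eq`). The frame condition is submersive
already along orbits. By the Jacobian criterion (`exists_topologicalKrullDim_zeroSet`) every
nonempty slice has dimension `2 (k_n + ∑ k_i k_{i+1}) - 2 ∑ k_i ^ 2`, and so does the quotient. -/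

noncomputable section

open Topology Set

/-! ### Polynomial functions and the Zariski topology -/

section PolynomialFunctions

variable {E E' : Type*} [AddCommGroup E] [Module ℂ E] [AddCommGroup E'] [Module ℂ E']

theorem dual_mem_polyFun (φ : Module.Dual ℂ E) : (φ : E → ℂ) ∈ polyFun E :=
  Algebra.subset_adjoin ⟨φ, rfl⟩

theorem const_mem_polyFun (c : ℂ) : (fun _ : E => c) ∈ polyFun E :=
  (polyFun E).algebraMap_mem c

theorem polyFun_comp_linear (L : E →ₗ[ℂ] E') {p : E' → ℂ} (hp : p ∈ polyFun E') :
    p ∘ L ∈ polyFun E := by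
  induction hp using Algebra.adjoin_induction with
  | mem x hx =>
    obtain ⟨φ, rfl⟩ := hx
    exact dual_mem_polyFun (φ ∘ₗ L)
  | algebraMap r => exact const_mem_polyFun r
  | add x y _ _ hx hy => exact (polyFun E).add_mem hx hy
  | mul x y _ _ hx hy => exact (polyFun E).mul_mem hx hy

theorem isOpen_zariski_basic (Z : Set E) {p : E → ℂ} (hp : p ∈ polyFun E) :
    IsOpen[zariski Z] {x : Z | p x ≠ 0} :=
  TopologicalSpace.isOpen_generateFrom_of_mem ⟨p, hp, rfl⟩

theorem isTopologicalBasis_zariski (Z : Set E) :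
    @TopologicalSpace.IsTopologicalBasis Z (zariski Z)
      {s | ∃ p ∈ polyFun E, s = {x : Z | p x ≠ 0}} := by
  let := zariski Z
  refine ⟨?_, ?_, rfl⟩
  · rintro _ ⟨p, hp, rfl⟩ _ ⟨q, hq, rfl⟩ x hx
    refine ⟨_, ⟨p * q, (polyFun E).mul_mem hp hq, rfl⟩, ?_, ?_⟩
    · exact mul_ne_zero hx.1 hx.2
    · intro y hy
      exact ⟨left_ne_zero_of_mul hy, right_ne_zero_of_mul hy⟩
  · refine eq_univ_of_forall fun x => ⟨_, ⟨_, const_mem_polyFun 1, rfl⟩, one_ne_zero⟩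

theorem continuous_zariski_of_linear {Z : Set E} {Z' : Set E'} (L : E →ₗ[ℂ] E') (f : Z → Z')
    (hf : ∀ x, (f x : E') = L x) : @Continuous _ _ (zariski Z) (zariski Z') f := by
  let := zariski Z
  refine continuous_generateFrom_iff.2 ?_
  rintro _ ⟨p, hp, rfl⟩
  have : f ⁻¹' {x : Z' | p x ≠ 0} = {x : Z | (p ∘ L) x ≠ 0} := by
    ext x
    simp [hf]
  rw [this]
  exact isOpen_zariski_basic Z (polyFun_comp_linear L hp)

theorem IsRegularOn.comp_linear {Z : Set E} {Z' : Set E'} (L : E →ₗ[ℂ] E') (f : Z → Z')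
    (hf : ∀ x, (f x : E') = L x) {O : Set Z'} {h : Z' → ℂ} (hh : IsRegularOn Z' O h) :
    IsRegularOn Z (f ⁻¹' O) (h ∘ f) := by
  intro x hx
  obtain ⟨p, hp, q, hq, hqx, H⟩ := hh (f x) hx
  refine ⟨_, polyFun_comp_linear L hp, _, polyFun_comp_linear L hq, ?_, fun y hy hqy => ?_⟩
  · simpa [← hf] using hqx
  · simpa [← hf] using H (f y) hy (by simpa [← hf] using hqy)

theorem isRegularOn_of_mem_polyFun {Z : Set E} (O : Set Z) {p : E → ℂ} (hp : p ∈ polyFun E) :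
    IsRegularOn Z O (fun x => p x) := fun _ _ =>
  ⟨p, hp, _, const_mem_polyFun 1, one_ne_zero, fun _ _ _ => by simp⟩

end PolynomialFunctions

/-! ### Polynomial maps between vector spaces -/

section PolynomialMaps

variable {E H H₁ H₂ H₃ : Type*} [AddCommGroup E] [Module ℂ E] [AddCommGroup H] [Module ℂ H]
  [AddCommGroup H₁] [Module ℂ H₁] [AddCommGroup H₂] [Module ℂ H₂] [AddCommGroup H₃] [Module ℂ H₃]

/-- A map between vector spaces is polynomial if all its coordinates are. -/
def IsPolyMap (F : E → H) : Prop :=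
  ∀ φ : Module.Dual ℂ H, (fun x => φ (F x)) ∈ polyFun E

theorem isPolyMap_linear (L : E →ₗ[ℂ] H) : IsPolyMap (fun x => L x) :=
  fun φ => dual_mem_polyFun (φ ∘ₗ L)

theorem isPolyMap_const (h : H) : IsPolyMap (fun _ : E => h) :=
  fun φ => const_mem_polyFun (φ h)

theorem IsPolyMap.mem_polyFun {F : E → ℂ} (hF : IsPolyMap F) : F ∈ polyFun E :=
  hF LinearMap.id

theorem isPolyMap_of_mem_polyFun {F : E → ℂ} (hF : F ∈ polyFun E) : IsPolyMap F := by
  intro φ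
  have : (fun x => φ (F x)) = φ 1 • F := by
    ext x
    simpa [mul_comm] using φ.map_smul (F x) 1
  rw [this]
  exact (polyFun E).smul_mem hF _

theorem IsPolyMap.add {F G : E → H} (hF : IsPolyMap F) (hG : IsPolyMap G) :
    IsPolyMap (fun x => F x + G x) := by
  intro φ
  simp only [map_add]
  exact (polyFun E).add_mem (hF φ) (hG φ)

theorem IsPolyMap.sub {F G : E → H} (hF : IsPolyMap F) (hG : IsPolyMap G) :
    IsPolyMap (fun x => F x - G x) := by
  intro φ
  simp only [map_sub]
  exact (polyFun E).sub_mem (hF φ) (hG φ)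

theorem IsPolyMap.linear_comp {F : E → H₁} (hF : IsPolyMap F) (L : H₁ →ₗ[ℂ] H₂) :
    IsPolyMap (fun x => L (F x)) :=
  fun φ => hF (φ ∘ₗ L)

theorem isPolyMap_id : IsPolyMap (fun x : E => x) := dual_mem_polyFun

theorem IsPolyMap.fst {F : E → H₁ × H₂} (hF : IsPolyMap F) : IsPolyMap (fun x => (F x).1) :=
  hF.linear_comp (LinearMap.fst ℂ H₁ H₂)

theorem IsPolyMap.snd {F : E → H₁ × H₂} (hF : IsPolyMap F) : IsPolyMap (fun x => (F x).2) :=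
  hF.linear_comp (LinearMap.snd ℂ H₁ H₂)

theorem IsPolyMap.proj {ι : Type*} {H : ι → Type*} [∀ i, AddCommGroup (H i)]
    [∀ i, Module ℂ (H i)] {F : E → ∀ i, H i} (hF : IsPolyMap F) (i : ι) :
    IsPolyMap (fun x => F x i) :=
  hF.linear_comp (LinearMap.proj (R := ℂ) (φ := H) i)

/-- Expanding `F x` in a basis of `H₁` turns the value into a finite sum of products of polynomial
functions. -/
theorem IsPolyMap.bilinear [FiniteDimensional ℂ H₁] {F : E → H₁} {G : E → H₂}
    (hF : IsPolyMap F) (hG : IsPolyMap G) (B : H₁ →ₗ[ℂ] H₂ →ₗ[ℂ] H₃) :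
    IsPolyMap (fun x => B (F x) (G x)) := by
  intro φ
  let b := Module.finBasis ℂ H₁
  have : (fun x => φ (B (F x) (G x)))
      = ∑ i, (fun x => b.coord i (F x)) * (fun x => φ (B (b i) (G x))) := by
    ext x
    have h := congrArg (fun y => φ (B y (G x))) (b.sum_repr (F x))
    simp only [map_sum, map_smul, LinearMap.sum_apply, LinearMap.smul_apply, smul_eq_mul] at h
    simp [← h]
  rw [this]
  exact (polyFun E).sum_mem fun i _ => (polyFun E).mul_mem (hF _) (hG (φ ∘ₗ B (b i)))

theorem IsPolyMap.pi {ι : Type*} [Fintype ι] {H : ι → Type*} [∀ i, AddCommGroup (H i)]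
    [∀ i, Module ℂ (H i)] {F : E → ∀ i, H i} (hF : ∀ i, IsPolyMap (fun x => F x i)) :
    IsPolyMap F := by
  classical
  intro φ
  have : (fun x => φ (F x))
      = ∑ i, (fun x => (φ ∘ₗ LinearMap.single ℂ H i) (F x i)) := by
    ext x
    conv_lhs => rw [← Finset.univ_sum_single (F x)]
    simp
  rw [this]
  exact (polyFun E).sum_mem fun i _ => hF i _

theorem IsPolyMap.prodMk {F : E → H₁} {G : E → H₂} (hF : IsPolyMap F) (hG : IsPolyMap G) :
    IsPolyMap (fun x => (F x, G x)) := by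
  intro φ
  have : (fun x => φ (F x, G x)) = (fun x => (φ ∘ₗ LinearMap.inl ℂ H₁ H₂) (F x))
      + (fun x => (φ ∘ₗ LinearMap.inr ℂ H₁ H₂) (G x)) := by
    ext x
    simp [← map_add]
  rw [this]
  exact (polyFun E).add_mem (hF _) (hG _)

theorem IsPolyMap.smul {f : E → ℂ} (hf : f ∈ polyFun E) {F : E → H} (hF : IsPolyMap F) :
    IsPolyMap (fun x => f x • F x) := by
  intro φ
  simp only [map_smul, smul_eq_mul]
  exact (polyFun E).mul_mem hf (hF φ)

theorem IsPolyMap.linearMap_comp [FiniteDimensional ℂ H₁] [FiniteDimensional ℂ H₂]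
    [FiniteDimensional ℂ H₃] {F : E → H₂ →ₗ[ℂ] H₃} {G : E → H₁ →ₗ[ℂ] H₂} (hF : IsPolyMap F)
    (hG : IsPolyMap G) : IsPolyMap (fun x => F x ∘ₗ G x) :=
  hF.bilinear hG (LinearMap.llcomp ℂ H₁ H₂ H₃)

theorem IsPolyMap.apply [FiniteDimensional ℂ H₁] [FiniteDimensional ℂ H₂]
    {F : E → H₁ →ₗ[ℂ] H₂} {G : E → H₁} (hF : IsPolyMap F) (hG : IsPolyMap G) :
    IsPolyMap (fun x => F x (G x)) :=
  hF.bilinear hG LinearMap.id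

theorem IsPolyMap.linearMap_of_basis [FiniteDimensional ℂ H₁] {ι : Type*} [Fintype ι]
    (b : Module.Basis ι ℂ H₁) {F : E → H₁ →ₗ[ℂ] H₂}
    (hF : ∀ i, IsPolyMap (fun x => F x (b i))) : IsPolyMap F :=
  (IsPolyMap.pi (F := fun x i => F x (b i)) hF).linear_comp (b.constr ℂ).toLinearMap |>
    fun h => by
      have : (fun x => (b.constr ℂ).toLinearMap fun i => F x (b i)) = F := by
        ext1 x
        exact b.ext fun i => b.constr_basis ℂ _ i
      rwa [this] at h

theorem prod_mem_polyFun {ι : Type*} (s : Finset ι) {f : ι → E → ℂ}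
    (hf : ∀ i ∈ s, f i ∈ polyFun E) : (fun x => ∏ i ∈ s, f i x) ∈ polyFun E := by
  have : (fun x => ∏ i ∈ s, f i x) = ∏ i ∈ s, f i := by
    ext x
    simp
  rw [this]
  exact (polyFun E).prod_mem hf

theorem matrix_det_mem_polyFun {ι : Type*} [Fintype ι] [DecidableEq ι] {M : E → Matrix ι ι ℂ}
    (hM : ∀ i j, (fun x => M x i j) ∈ polyFun E) : (fun x => (M x).det) ∈ polyFun E := by
  have : (fun x => (M x).det)
      = ∑ σ : Equiv.Perm ι, ((Equiv.Perm.sign σ : ℤ) : ℂ) • fun x => ∏ i, M x (σ i) i := by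
    ext x
    simp [Matrix.det_apply']
  rw [this]
  exact (polyFun E).sum_mem fun σ _ =>
    (polyFun E).smul_mem (prod_mem_polyFun _ fun i _ => hM _ _) _

/-- Polynomial families of endomorphisms have polynomial determinants and adjugates. -/
theorem IsPolyMap.exists_adjugate [FiniteDimensional ℂ H] {F : E → H →ₗ[ℂ] H} (hF : IsPolyMap F) :
    (fun x => LinearMap.det (F x)) ∈ polyFun E ∧ ∃ A : E → H →ₗ[ℂ] H, IsPolyMap A ∧
      ∀ x, A x ∘ₗ F x = LinearMap.det (F x) • LinearMap.id := by
  classical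
  let b := Module.finBasis ℂ H
  have hM : ∀ i j, (fun x => LinearMap.toMatrix b b (F x) i j) ∈ polyFun E := fun i j => by
    simp only [LinearMap.toMatrix_apply]
    exact (hF.apply (isPolyMap_const (b j))) (b.coord i)
  refine ⟨by simpa only [LinearMap.det_toMatrix] using matrix_det_mem_polyFun hM,
    fun x => Matrix.toLin b b (LinearMap.toMatrix b b (F x)).adjugate, ?_, fun x => ?_⟩
  · refine IsPolyMap.linear_comp (L := (Matrix.toLin b b).toLinearMap)
      (F := fun x => (LinearMap.toMatrix b b (F x)).adjugate) ?_
    refine IsPolyMap.pi fun i => IsPolyMap.pi fun j => isPolyMap_of_mem_polyFun ?_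
    simp only [Matrix.adjugate_apply]
    refine matrix_det_mem_polyFun fun k l => ?_
    simp only [Matrix.updateRow_apply]
    split_ifs
    · exact const_mem_polyFun _
    · exact hM k l
  · apply (LinearMap.toMatrix b b).injective
    rw [LinearMap.toMatrix_comp b b b, LinearMap.toMatrix_toLin, Matrix.adjugate_mul]
    simp [LinearMap.det_toMatrix]

end PolynomialMaps


/-! ### The Jacobian criterion at a point -/

section Jacobian

open MvPolynomial

variable {σ κ : Type*} [Fintype σ] [Fintype κ]

/-- Links formal partial derivatives to derivatives along lines, so that submersivity can be checked
analytically and used algebraically. -/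
theorem MvPolynomial.hasDerivAt_eval_line (a v : σ → ℂ) (f : MvPolynomial σ ℂ) :
    HasDerivAt (fun t : ℂ => eval (a + t • v) f) (∑ i, eval a (pderiv i f) * v i) 0 := by
  classical
  induction f using MvPolynomial.induction_on with
  | C c => simpa using hasDerivAt_const (0 : ℂ) c
  | add p q hp hq =>
    simp only [map_add, add_mul, Finset.sum_add_distrib]
    exact hp.add hq
  | mul_X p j hp =>
    have hX : HasDerivAt (fun t : ℂ => a j + t * v j) (v j) 0 := by
      simpa using ((hasDerivAt_id (0 : ℂ)).mul_const (v j)).const_add (a j)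
    have h := hp.mul hX
    simp only [zero_smul, add_zero, zero_mul] at h
    convert! h using 1
    · ext t
      simp
    · simp only [Derivation.leibniz, smul_eq_mul, pderiv_X, map_add, map_mul, eval_X, add_mul,
        Finset.sum_add_distrib]
      rw [add_comm, Finset.sum_mul]
      congr 1
      · exact Finset.sum_congr rfl fun i _ => by ring
      · rw [Finset.sum_eq_single j]
        · simp
        · intro i _ hi
          simp [hi.symm]
        · simp

/-- The linear form with coefficients `w`, centred at `a`. -/
def MvPolynomial.centredLinear (a : σ → ℂ) : (σ → ℂ) →ₗ[ℂ] MvPolynomial σ ℂ where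
  toFun w := ∑ i, C (w i) * (X i - C (a i))
  map_add' w w' := by simp [add_mul, Finset.sum_add_distrib]
  map_smul' c w := by simp [Finset.mul_sum, mul_assoc, smul_eq_C_mul]

theorem MvPolynomial.centredLinear_mem (a w : σ → ℂ) :
    centredLinear a w ∈ vanishingIdeal ℂ {a} := by
  simp [centredLinear]

/-- First-order Taylor expansion: the class of `f - f(a)` in the cotangent space `m / m ^ 2` of the
point is given by the gradient of `f`. -/
theorem MvPolynomial.sub_centredLinear_mem_sq (a : σ → ℂ) (f : MvPolynomial σ ℂ) :
    f - C (eval a f) - centredLinear a (fun i => eval a (pderiv i f))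
      ∈ vanishingIdeal ℂ {a} ^ 2 := by
  classical
  induction f using MvPolynomial.induction_on with
  | C c => simp [centredLinear]
  | add p q hp hq =>
    convert! add_mem hp hq using 1
    simp only [map_add]
    rw [show (fun i => eval a (pderiv i p) + eval a (pderiv i q))
      = (fun i => eval a (pderiv i p)) + fun i => eval a (pderiv i q) from rfl, map_add]
    ring
  | mul_X p j hp =>
    -- The remainder of `p * X j` is the remainder of `p` times `X j`, plus the linear part of `p`
    -- times `X j - a j`; both lie in the square.
    have h1 := Ideal.mul_mem_right (X j) _ hp
    have hX : (X j - C (a j) : MvPolynomial σ ℂ) ∈ vanishingIdeal ℂ {a} := by simp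
    have h2 := Ideal.mul_mem_mul (centredLinear_mem a (fun i => eval a (pderiv i p))) hX
    rw [← pow_two] at h2
    convert! add_mem h1 h2 using 1
    have h3 : (fun i => eval a (pderiv i (p * X j)))
        = a j • (fun i => eval a (pderiv i p)) + eval a p • Pi.single j (1 : ℂ) := by
      ext i
      simp only [Derivation.leibniz, smul_eq_mul, pderiv_X, map_add, map_mul, eval_X, Pi.add_apply,
        Pi.smul_apply]
      by_cases hij : i = j
      · subst hij
        simp
        ring
      · simp [hij, Ne.symm hij]
    have h4 : centredLinear a (Pi.single j (1 : ℂ)) = X j - C (a j) := by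
      simp only [centredLinear, LinearMap.coe_mk, AddHom.coe_mk]
      rw [Finset.sum_eq_single j]
      · simp
      · intro i _ hi
        simp [hi]
      · simp
    rw [h3, map_add, map_smul, map_smul, h4, smul_eq_C_mul, smul_eq_C_mul]
    simp only [map_mul, eval_X]
    ring

theorem linearIndependent_of_forall_dotProduct {g : κ → σ → ℂ}
    (hg : ∀ h : κ → ℂ, ∃ v : σ → ℂ, ∀ k, ∑ i, g k i * v i = h k) : LinearIndependent ℂ g := by
  classical
  refine Fintype.linearIndependent_iff.2 fun c hc k => ?_
  obtain ⟨v, hv⟩ := hg (Pi.single k 1)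
  have h : ∑ i, (∑ l, c l • g l) i * v i = 0 := by simp only [hc]; simp
  simp only [Finset.sum_apply, Pi.smul_apply, smul_eq_mul, Finset.sum_mul, mul_assoc] at h
  rw [Finset.sum_comm] at h
  simp only [← Finset.mul_sum, hv] at h
  simpa [Pi.single_apply] using h

/-- At a point where the differentials of the equations `f` are linearly independent, the
height of the point in the quotient by `f` is at most the expected dimension. -/
theorem MvPolynomial.height_map_vanishingIdeal_le (f : κ → MvPolynomial σ ℂ) (a : σ → ℂ)
    (hfa : ∀ k, eval a (f k) = 0)
    (hg : LinearIndependent ℂ fun k i => eval a (pderiv i (f k))) :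
    ((vanishingIdeal ℂ {a}).map (Ideal.Quotient.mk (Ideal.span (range f)))).height
      ≤ (Fintype.card σ - Fintype.card κ : ℕ) := by
  classical
  set g : κ → σ → ℂ := fun k i => eval a (pderiv i (f k)) with hgdef
  set m : Ideal (MvPolynomial σ ℂ) := vanishingIdeal ℂ {a} with hm
  set I := Ideal.span (range f) with hI
  -- The gradients span the conormal directions. Linear forms from a complement `W` supply the
  -- missing generators of the cotangent space, and their number is the expected dimension.
  obtain ⟨W, hW⟩ := Submodule.exists_isCompl (Submodule.span ℂ (range g))
  have hrank : Module.finrank ℂ W = Fintype.card σ - Fintype.card κ := by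
    have h1 := Submodule.finrank_add_eq_of_isCompl hW
    rw [finrank_span_eq_card hg, Module.finrank_fintype_fun_eq_card] at h1
    omega
  let w := Module.finBasis ℂ W
  let s : Set (MvPolynomial σ ℂ) := range fun j => centredLinear a (w j : σ → ℂ)
  have hIm : I ≤ m := by
    rw [hI, Ideal.span_le]
    rintro _ ⟨k, rfl⟩
    simpa [hm, coe_aeval_eq_eval] using hfa k
  have hsm : s ⊆ m := by
    rintro _ ⟨j, rfl⟩
    exact centredLinear_mem a _
  -- Modulo `m ^ 2`, the equations and the forms in `s` generate `m`: this is the input for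
  -- Nakayama's lemma.
  have hgen : ∀ P : Ideal (MvPolynomial σ ℂ), I ≤ P → s ⊆ P → m ≤ P ⊔ m • m := by
    intro P hIP hsP
    let K : Submodule ℂ (σ → ℂ) :=
      ((P ⊔ m • m).restrictScalars ℂ).comap (centredLinear a)
    have hK : K = ⊤ := by
      rw [eq_top_iff, ← hW.sup_eq_top, sup_le_iff]
      constructor
      · rw [Submodule.span_le]
        rintro _ ⟨k, rfl⟩
        have h1 := sub_centredLinear_mem_sq a (f k)
        rw [hfa k, map_zero, sub_zero, pow_two] at h1
        have h2 : f k ∈ P ⊔ m • m :=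
          Ideal.mem_sup_left (hIP (Ideal.subset_span ⟨k, rfl⟩))
        have h3 : f k - centredLinear a (g k) ∈ P ⊔ m • m := Ideal.mem_sup_right h1
        have := sub_mem h2 h3
        rwa [sub_sub_cancel] at this
      · intro x hx
        have hx' : x ∈ (⊤ : Submodule ℂ W).map W.subtype := by simpa using hx
        rw [← w.span_eq, Submodule.map_span] at hx'
        refine Submodule.span_le.2 ?_ hx'
        rintro _ ⟨_, ⟨j, rfl⟩, rfl⟩
        exact Ideal.mem_sup_left (hsP ⟨j, rfl⟩)
    intro p hp
    have h0 : eval a p = 0 := by simpa [hm, coe_aeval_eq_eval] using hp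
    have h1 := sub_centredLinear_mem_sq a p
    rw [h0, map_zero, sub_zero, pow_two] at h1
    have h2 : (fun i => eval a (pderiv i p)) ∈ K := hK ▸ Submodule.mem_top
    have := add_mem (show p - _ ∈ P ⊔ m • m from Ideal.mem_sup_right h1)
      (show centredLinear a (fun i => eval a (pderiv i p)) ∈ P ⊔ m • m from h2)
    rwa [sub_add_cancel] at this
  have hprime : (m.map (Ideal.Quotient.mk I)).IsPrime :=
    Ideal.isPrime_map_quotientMk_of_isPrime hIm
  -- The point is a minimal prime over the ideal generated by `s` in the quotient, so Krull's height
  -- theorem bounds its height by the size of `s`.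
  have hmin : m.map (Ideal.Quotient.mk I)
      ∈ (Ideal.span (Ideal.Quotient.mk I '' s)).minimalPrimes := by
    refine ⟨⟨hprime, ?_⟩, ?_⟩
    · rw [Ideal.span_le]
      rintro _ ⟨x, hx, rfl⟩
      exact Ideal.mem_map_of_mem _ (hsm hx)
    · rintro Q ⟨hQ, hsQ⟩ hQm
      set P := Q.comap (Ideal.Quotient.mk I) with hP
      have hPm : P ≤ m := by
        have := Ideal.comap_mono (f := Ideal.Quotient.mk I) hQm
        rwa [Ideal.comap_map_of_surjective _ Ideal.Quotient.mk_surjective,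
          ← RingHom.ker_eq_comap_bot, Ideal.mk_ker, sup_eq_left.2 hIm] at this
      have hPprime : P.IsPrime := Ideal.IsPrime.comap _
      have hIP : I ≤ P := by
        intro x hx
        rw [hP, Ideal.mem_comap, Ideal.Quotient.eq_zero_iff_mem.2 hx]
        exact Q.zero_mem
      have hsP : s ⊆ P := fun x hx => hsQ (Ideal.subset_span ⟨x, hx, rfl⟩)
      -- Nakayama without localizing: some `r` congruent to `1` modulo `m` multiplies `m` into `P`.
      -- It lies outside `m`, hence outside the prime `P`, so `m ≤ P`.
      obtain ⟨r, hr1, hr2⟩ := Submodule.exists_sub_one_mem_and_smul_le_of_fg_of_le_sup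
        (I := m) (N := P) (N' := m) (P := m) (IsNoetherian.noetherian m) le_rfl
        (hgen P hIP hsP)
      have hrm : r ∉ m := fun h => (inferInstance : m.IsPrime).one_notMem
        (by simpa using sub_mem h hr1)
      rw [Ideal.map_le_iff_le_comap]
      intro x hx
      exact (hPprime.mem_or_mem (hr2 (Submodule.smul_mem_pointwise_smul x r m hx))).resolve_left
        fun h => hrm (hPm h)
  have hfin : s.Finite := finite_range _
  refine (Ideal.height_le_card_of_mem_minimalPrimes_span (hfin.image _) hmin).trans ?_
  refine Nat.cast_le.2 ((ncard_image_le hfin).trans ?_)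
  rw [show s = _ '' univ from image_univ.symm]
  refine (ncard_image_le finite_univ).trans ?_
  simp [ncard_univ, hrank]

end Jacobian


/-! ### Krull dimension of a smooth complete intersection -/

section AffineDimension

open MvPolynomial

variable {σ κ : Type*} [Fintype σ] [Fintype κ]

/-- Translation of the variables, as an automorphism of the polynomial ring. -/
def MvPolynomial.translate (c : σ → ℂ) : MvPolynomial σ ℂ ≃ₐ[ℂ] MvPolynomial σ ℂ :=
  AlgEquiv.ofAlgHom (aeval fun i => X i + C (c i)) (aeval fun i => X i - C (c i))
    (by ext i; simp) (by ext i; simp)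

/-- Some maximal ideal attains the dimension of the polynomial ring. By the Nullstellensatz it is
the ideal of a point, and translations are automorphisms moving that point to any other. -/
theorem MvPolynomial.card_le_height_vanishingIdeal (a : σ → ℂ) :
    (Fintype.card σ : ℕ∞) ≤ (vanishingIdeal ℂ {a} : Ideal (MvPolynomial σ ℂ)).height := by
  have hdim : ringKrullDim (MvPolynomial σ ℂ) = (Fintype.card σ : ℕ∞) := by
    rw [ringKrullDim_of_isNoetherianRing, ringKrullDim_eq_zero_of_field, zero_add,
      Nat.card_eq_fintype_card]
    rfl
  have : FiniteRingKrullDim (MvPolynomial σ ℂ) := by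
    rw [finiteRingKrullDim_iff_ne_bot_and_top, hdim]
    exact ⟨WithBot.coe_ne_bot, fun h => ENat.natCast_ne_top _ (WithBot.coe_injective h)⟩
  obtain ⟨p, hp, hht⟩ := Ideal.exists_isMaximal_height (R := MvPolynomial σ ℂ)
  obtain ⟨b, rfl⟩ := isMaximal_iff_eq_vanishingIdeal_singleton.1 hp
  have hcomap : (vanishingIdeal ℂ {a}).comap (translate (b - a)).toRingEquiv
      = (vanishingIdeal ℂ {b} : Ideal (MvPolynomial σ ℂ)) := by
    ext f
    have h : (aeval a : MvPolynomial σ ℂ →ₐ[ℂ] ℂ).comp (translate (b - a)).toAlgHom = aeval b := by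
      ext i
      simp [translate]
    rw [Ideal.mem_comap, mem_vanishingIdeal_singleton_iff, mem_vanishingIdeal_singleton_iff,
      ← AlgHom.congr_fun h f]
    rfl
  have h := RingEquiv.height_comap (translate (b - a)).toRingEquiv
    (vanishingIdeal ℂ {a} : Ideal (MvPolynomial σ ℂ))
  rw [hcomap] at h
  rw [← h]
  rw [hdim] at hht
  exact (WithBot.coe_injective hht).ge

/-- The upper bound is the height bound at each closed point. The lower bound needs only one point
of the zero set: passing to a quotient by `card κ` equations lowers the height by at most `card κ`.
-/
theorem MvPolynomial.ringKrullDim_quotient_span (f : κ → MvPolynomial σ ℂ)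
    (hne : ∃ a, ∀ k, eval a (f k) = 0)
    (hg : ∀ a, (∀ k, eval a (f k) = 0) →
      LinearIndependent ℂ fun k i => eval a (pderiv i (f k))) :
    ringKrullDim (MvPolynomial σ ℂ ⧸ Ideal.span (range f))
      = (Fintype.card σ - Fintype.card κ : ℕ) := by
  set I := Ideal.span (range f) with hI
  apply le_antisymm
  · rw [ringKrullDim_le_iff_isMaximal_height_le]
    intro M hM
    have hM' : (M.comap (Ideal.Quotient.mk I)).IsMaximal :=
      Ideal.comap_isMaximal_of_surjective _ Ideal.Quotient.mk_surjective
    obtain ⟨a, ha⟩ := isMaximal_iff_eq_vanishingIdeal_singleton.1 hM'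
    have hfa : ∀ k, eval a (f k) = 0 := by
      intro k
      have h : f k ∈ M.comap (Ideal.Quotient.mk I) := by
        rw [Ideal.mem_comap, 
          Ideal.Quotient.eq_zero_iff_mem.2 (show f k ∈ I from Ideal.subset_span ⟨k, rfl⟩)]
        exact M.zero_mem
      rw [ha] at h
      simpa [coe_aeval_eq_eval] using h
    have h := height_map_vanishingIdeal_le f a hfa (hg a hfa)
    rw [← ha, Ideal.map_comap_of_surjective _ Ideal.Quotient.mk_surjective] at h
    exact WithBot.coe_le_coe.2 h
  · obtain ⟨a, ha⟩ := hne
    have hIm : I ≤ vanishingIdeal ℂ {a} := by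
      rw [hI, Ideal.span_le]
      rintro _ ⟨k, rfl⟩
      simpa [coe_aeval_eq_eval] using ha k
    have h1 := height_le_ringKrullDim_quotient_add_spanFinrank hIm
    have h2 : I.spanFinrank ≤ Fintype.card κ := by
      refine (Submodule.spanFinrank_span_le_ncard_of_finite (finite_range f)).trans ?_
      rw [← image_univ]
      refine (ncard_image_le finite_univ).trans ?_
      simp [ncard_univ]
    have h3 : ((Fintype.card σ : ℕ∞) : WithBot ℕ∞)
        ≤ ringKrullDim (MvPolynomial σ ℂ ⧸ I) + (Fintype.card κ : ℕ) :=
      (WithBot.coe_le_coe.2 (card_le_height_vanishingIdeal a)).trans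
        (h1.trans (add_le_add le_rfl (by exact_mod_cast h2)))
    generalize ringKrullDim (MvPolynomial σ ℂ ⧸ I) = D at h3
    induction D with
    | bot => simp at h3
    | coe D =>
      induction D with
      | top => exact le_top
      | coe D =>
        norm_cast at h3
        exact WithBot.coe_le_coe.2 (Nat.cast_le.2 (by omega))

end AffineDimension

/-! ### Comparing the Zariski topology with the prime spectrum -/

section ZariskiSpectrum

open MvPolynomial

variable {E : Type*} [AddCommGroup E] [Module ℂ E] {σ : Type*} [Fintype σ]

theorem mem_polyFun_iff_exists_mvPolynomial (b : Module.Basis σ ℂ E) {p : E → ℂ} :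
    p ∈ polyFun E ↔ ∃ f : MvPolynomial σ ℂ, ∀ x, p x = eval (b.equivFun x) f := by
  constructor
  · intro hp
    induction hp using Algebra.adjoin_induction with
    | mem x hx =>
      obtain ⟨φ, rfl⟩ := hx
      refine ⟨∑ i, C (φ (b i)) * X i, fun x => ?_⟩
      have h := congrArg φ (b.sum_equivFun x)
      simp only [map_sum, map_smul, smul_eq_mul] at h
      simp [← h, mul_comm]
    | algebraMap r => exact ⟨C r, fun x => by simp⟩
    | add x y _ _ hx hy =>
      obtain ⟨f, hf⟩ := hx
      obtain ⟨g, hg⟩ := hy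
      exact ⟨f + g, fun x => by simp [hf, hg]⟩
    | mul x y _ _ hx hy =>
      obtain ⟨f, hf⟩ := hx
      obtain ⟨g, hg⟩ := hy
      exact ⟨f * g, fun x => by simp [hf, hg]⟩
  · rintro ⟨f, hf⟩
    have : p = fun x => eval (b.equivFun x) f := funext hf
    rw [this]
    clear this hf
    induction f using MvPolynomial.induction_on with
    | C c => simpa using const_mem_polyFun c
    | add f g hf hg =>
      simp only [map_add]
      exact (polyFun E).add_mem hf hg
    | mul_X f i hf =>
      simp only [map_mul, eval_X]
      exact (polyFun E).mul_mem hf (dual_mem_polyFun (b.coord i))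

/-- Both topologies are generated by the nonvanishing sets of polynomials. -/
theorem isInducing_pointToPoint (b : Module.Basis σ ℂ E) (Z : Set E) :
    @IsInducing Z _ (zariski Z) _
      (fun x => (pointToPoint (b.equivFun x) : PrimeSpectrum (MvPolynomial σ ℂ))) := by
  let := zariski Z
  refine ⟨?_⟩
  rw [PrimeSpectrum.isTopologicalBasis_basic_opens.eq_generateFrom, induced_generateFrom_eq]
  change TopologicalSpace.generateFrom _ = _
  congr 1
  ext s
  constructor
  · rintro ⟨p, hp, rfl⟩
    obtain ⟨f, hf⟩ := (mem_polyFun_iff_exists_mvPolynomial b).1 hp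
    refine ⟨_, ⟨f, rfl⟩, ?_⟩
    ext x
    simp [pointToPoint, hf]
  · rintro ⟨_, ⟨f, rfl⟩, rfl⟩
    refine ⟨_, (mem_polyFun_iff_exists_mvPolynomial b).2 ⟨f, fun _ => rfl⟩, ?_⟩
    ext x
    simp [pointToPoint]

/-- The points of `Z` in the zero locus of a prime form an irreducible closed set. -/
theorem isIrreducible_zeroLocus (b : Module.Basis σ ℂ E) (Z : Set E)
    (P : Ideal (MvPolynomial σ ℂ)) [hP : P.IsPrime]
    (hZ : ∀ x, (∀ f ∈ P, eval (b.equivFun x) f = 0) → x ∈ Z) :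
    @IsIrreducible Z (zariski Z) {x : Z | ∀ f ∈ P, eval (b.equivFun x) f = 0} ∧
    IsClosed[zariski Z] {x : Z | ∀ f ∈ P, eval (b.equivFun x) f = 0} := by
  let := zariski Z
  -- Nullstellensatz for the prime `P`: a polynomial vanishing at all its zeros, which lie in `Z`,
  -- belongs to `P`.
  have hmem : ∀ f : MvPolynomial σ ℂ,
      (∀ x : Z, (∀ f ∈ P, eval (b.equivFun x) f = 0) → eval (b.equivFun x) f = 0) → f ∈ P := by
    intro f hf
    rw [← IsPrime.vanishingIdeal_zeroLocus (K := ℂ) P, mem_vanishingIdeal_iff]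
    intro y hy
    have hy' : ∀ f ∈ P, eval (b.equivFun (b.equivFun.symm y)) f = 0 := by
      simpa [coe_aeval_eq_eval, -Module.Basis.equivFun_symm_apply] using hy
    simpa [coe_aeval_eq_eval, -Module.Basis.equivFun_symm_apply] using
      hf ⟨b.equivFun.symm y, hZ _ hy'⟩ hy'
  refine ⟨⟨?_, ?_⟩, ?_⟩
  · by_contra h
    rw [not_nonempty_iff_eq_empty] at h
    refine hP.one_notMem (hmem 1 fun x hx => ?_)
    exact absurd (show x ∈ (∅ : Set Z) from h ▸ hx) (notMem_empty x)
  · rw [IsPreirreducible]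
    intro u v hu hv hu' hv'
    obtain ⟨x, hxP, hxu⟩ := hu'
    obtain ⟨y, hyP, hyv⟩ := hv'
    obtain ⟨_, ⟨p, hp, rfl⟩, hxp, hpu⟩ :=
      (isTopologicalBasis_zariski Z).exists_subset_of_mem_open hxu hu
    obtain ⟨_, ⟨q, hq, rfl⟩, hyq, hqv⟩ :=
      (isTopologicalBasis_zariski Z).exists_subset_of_mem_open hyv hv
    obtain ⟨f, hf⟩ := (mem_polyFun_iff_exists_mvPolynomial b).1 hp
    obtain ⟨g, hg⟩ := (mem_polyFun_iff_exists_mvPolynomial b).1 hq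
    by_contra h
    rw [not_nonempty_iff_eq_empty] at h
    have hfg : f * g ∈ P := by
      refine hmem _ fun z hz => ?_
      by_contra hne
      rw [map_mul] at hne
      refine absurd (show z ∈ (∅ : Set Z) from h ▸ ⟨hz, hpu ?_, hqv ?_⟩) (notMem_empty z)
      · simpa [hf] using left_ne_zero_of_mul hne
      · simpa [hg] using right_ne_zero_of_mul hne
    rcases hP.mem_or_mem hfg with h' | h'
    · exact hxp ((hf _).trans (hxP f h'))
    · exact hyq ((hg _).trans (hyP g h'))
  · have h : {x : Z | ∀ f ∈ P, eval (b.equivFun x) f = 0}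
        = ⋂ f ∈ P, {x : Z | eval (b.equivFun x) f ≠ 0}ᶜ := by
      ext x
      simp
    rw [h]
    exact isClosed_biInter fun f _ => (isOpen_zariski_basic Z
      ((mem_polyFun_iff_exists_mvPolynomial b).2 ⟨f, fun _ => rfl⟩)).isClosed_compl

/-- A closed subvariety has the Krull dimension of its coordinate ring. -/
theorem topologicalKrullDim_zariski (b : Module.Basis σ ℂ E) (Z : Set E)
    (I : Ideal (MvPolynomial σ ℂ)) (hZ : ∀ x, x ∈ Z ↔ ∀ f ∈ I, eval (b.equivFun x) f = 0) :
    @topologicalKrullDim Z (zariski Z) = ringKrullDim (MvPolynomial σ ℂ ⧸ I) := by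
  let := zariski Z
  rw [ringKrullDim_quotient]
  apply le_antisymm
  -- The set `Z` carries the topology induced from the closed subset of the spectrum defined by `I`,
  -- so its dimension is no larger.
  · rw [topologicalKrullDim, Order.krullDim_eq_of_orderIso
      (PrimeSpectrum.zeroLocusEquivIrreducibleCloseds (I : Set (MvPolynomial σ ℂ))),
      Order.krullDim_orderDual]
    refine IsInducing.topologicalKrullDim_le (f := fun x : Z =>
      (⟨pointToPoint (b.equivFun x), fun f hf => ?_⟩ :
        PrimeSpectrum.zeroLocus (I : Set (MvPolynomial σ ℂ)))) ?_
    · simpa [pointToPoint, coe_aeval_eq_eval] using (hZ x).1 x.2 f hf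
    · exact (IsInducing.of_comp_iff IsInducing.subtypeVal).1 (isInducing_pointToPoint b Z)
  · rw [← Order.krullDim_orderDual]
    have hsub : ∀ P : PrimeSpectrum.zeroLocus (I : Set (MvPolynomial σ ℂ)), ∀ x,
        (∀ f ∈ P.1.asIdeal, eval (b.equivFun x) f = 0) → x ∈ Z :=
      fun P x hx => (hZ x).2 fun f hf => hx f (P.2 hf)
    -- Conversely a chain of primes over `I` gives a chain of zero sets. It stays strict because a
    -- prime is recovered from its zeros.
    refine Order.krullDim_le_of_strictMono
      (fun P : (PrimeSpectrum.zeroLocus (I : Set (MvPolynomial σ ℂ)))ᵒᵈ =>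
        (⟨_, (isIrreducible_zeroLocus b Z (OrderDual.ofDual P).1.asIdeal (hsub _)).1,
          (isIrreducible_zeroLocus b Z (OrderDual.ofDual P).1.asIdeal (hsub _)).2⟩ :
          TopologicalSpace.IrreducibleCloseds Z)) ?_
    intro P Q hPQ
    have hlt : (OrderDual.ofDual Q).1.asIdeal < (OrderDual.ofDual P).1.asIdeal := hPQ
    refine lt_of_le_not_ge (fun x hx f hf => hx f (hlt.le hf)) fun hle => hlt.not_ge ?_
    rw [← IsPrime.vanishingIdeal_zeroLocus (K := ℂ) (OrderDual.ofDual Q).1.asIdeal]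
    intro f hf
    rw [mem_vanishingIdeal_iff]
    intro y hy
    have hy' : ∀ f ∈ (OrderDual.ofDual Q).1.asIdeal,
        eval (b.equivFun (b.equivFun.symm y)) f = 0 := by
      simpa [coe_aeval_eq_eval, -Module.Basis.equivFun_symm_apply] using hy
    have := @hle ⟨b.equivFun.symm y, hsub _ _ hy'⟩ hy'
    simpa [coe_aeval_eq_eval, -Module.Basis.equivFun_symm_apply] using this f hf

end ZariskiSpectrum

/-! ### Derivatives tested against functionals, and the dimension of zero sets -/

section WeakDerivatives

variable {W W' : Type*} [AddCommGroup W] [Module ℂ W] [AddCommGroup W'] [Module ℂ W']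

/-- The curve `c` has derivative `w` at `0`, after applying any linear functional. -/
def HasWeakDeriv (c : ℂ → W) (w : W) : Prop :=
  ∀ φ : Module.Dual ℂ W, HasDerivAt (fun t => φ (c t)) (φ w) 0

theorem HasWeakDeriv.unique {c : ℂ → W} {w w' : W} (h : HasWeakDeriv c w)
    (h' : HasWeakDeriv c w') : w = w' := by
  rw [← sub_eq_zero, ← Module.forall_dual_apply_eq_zero_iff ℂ]
  intro φ
  rw [map_sub, (h φ).unique (h' φ), sub_self]

theorem hasWeakDeriv_const (w : W) : HasWeakDeriv (fun _ => w) 0 := fun φ => by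
  simpa using hasDerivAt_const (0 : ℂ) (φ w)

theorem HasWeakDeriv.linear_comp {c : ℂ → W} {w : W} (h : HasWeakDeriv c w) (L : W →ₗ[ℂ] W') :
    HasWeakDeriv (fun t => L (c t)) (L w) :=
  fun φ => h (φ ∘ₗ L)

theorem HasWeakDeriv.add {c c' : ℂ → W} {w w' : W} (h : HasWeakDeriv c w)
    (h' : HasWeakDeriv c' w') : HasWeakDeriv (fun t => c t + c' t) (w + w') := by
  intro φ
  simp only [map_add]
  exact (h φ).add (h' φ)

theorem HasWeakDeriv.smul_id {c : ℂ → W} {w : W} (h : HasWeakDeriv c w) :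
    HasWeakDeriv (fun t => t • c t) (c 0) := by
  intro φ
  simp only [map_smul, smul_eq_mul]
  have h1 := (hasDerivAt_id' (0 : ℂ)).fun_mul (h φ)
  simpa only [one_mul, zero_mul, add_zero] using h1

/-- The product rule for applying an affine family of operators. -/
theorem HasWeakDeriv.affine_apply {c : ℂ → W} {w : W} (h : HasWeakDeriv c w) (A B : W →ₗ[ℂ] W') :
    HasWeakDeriv (fun t => (A + t • B) (c t)) (A w + B (c 0)) := by
  simp only [LinearMap.add_apply, LinearMap.smul_apply]
  exact (h.linear_comp A).add (h.linear_comp B).smul_id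

theorem hasWeakDeriv_affine (a b : W) : HasWeakDeriv (fun t => a + t • b) b := by
  simpa using (hasWeakDeriv_const a).add (hasWeakDeriv_const b).smul_id

variable {E H : Type*} [AddCommGroup E] [Module ℂ E] [FiniteDimensional ℂ E] [AddCommGroup H]
  [Module ℂ H] [FiniteDimensional ℂ H]

/-- A polynomial map has a linear derivative at each point. -/
theorem IsPolyMap.exists_weakDeriv {F : E → H} (hF : IsPolyMap F) (z : E) :
    ∃ D : E →ₗ[ℂ] H, ∀ v, HasWeakDeriv (fun t => F (z + t • v)) (D v) := by
  let b := Module.finBasis ℂ E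
  let c := Module.finBasis ℂ H
  choose f hf using fun k => (mem_polyFun_iff_exists_mvPolynomial b).1 (hF (c.coord k))
  let g : ∀ k, E →ₗ[ℂ] ℂ := fun k =>
    ∑ i, MvPolynomial.eval (b.equivFun z) (MvPolynomial.pderiv i (f k)) • b.coord i
  refine ⟨∑ k, (g k).smulRight (c k), fun v φ => ?_⟩
  have hk : ∀ k, HasDerivAt (fun t : ℂ => c.coord k (F (z + t • v))) (g k v) 0 := by
    intro k
    have h := MvPolynomial.hasDerivAt_eval_line (b.equivFun z) (b.equivFun v) (f k)
    simp only [hf, map_add, map_smul]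
    convert! h using 1
    simp [g]
  have hsum : (fun t : ℂ => φ (F (z + t • v)))
      = fun t => ∑ k, c.coord k (F (z + t • v)) * φ (c k) := by
    ext t
    have h := congrArg φ (c.sum_repr (F (z + t • v)))
    simp only [map_sum, map_smul, smul_eq_mul] at h
    simp [← h]
  rw [hsum]
  convert! HasDerivAt.fun_sum fun k (_ : k ∈ Finset.univ) => (hk k).mul_const (φ (c k)) using 1
  simp

end WeakDerivatives

/-- **Dimension of a smooth complete intersection.** If the derivative of a polynomial map `F` is
onto at each of its zeros, then the zero set, if non-empty, has dimension `dim E - dim H`. -/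
theorem exists_topologicalKrullDim_zeroSet {E H : Type*} [AddCommGroup E] [Module ℂ E]
    [FiniteDimensional ℂ E] [AddCommGroup H] [Module ℂ H] [FiniteDimensional ℂ H]
    {F : E → H} (hF : IsPolyMap F)
    (hD : ∀ z, F z = 0 → ∀ h : H, ∃ v : E, HasWeakDeriv (fun t => F (z + t • v)) h)
    (hne : ∃ z, F z = 0) :
    ∃ d : ℕ, @topologicalKrullDim {z | F z = 0} (zariski {z | F z = 0}) = d ∧
      d + Module.finrank ℂ H = Module.finrank ℂ E := by
  classical
  let b := Module.finBasis ℂ E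
  let c := Module.finBasis ℂ H
  choose f hf using fun k => (mem_polyFun_iff_exists_mvPolynomial b).1 (hF (c.coord k))
  have hF0 : ∀ z, F z = 0 ↔ ∀ k, MvPolynomial.eval (b.equivFun z) (f k) = 0 := by
    intro z
    simp only [← hf]
    exact c.forall_coord_eq_zero_iff.symm
  have hg : ∀ a, (∀ k, MvPolynomial.eval a (f k) = 0) →
      LinearIndependent ℂ fun k i => MvPolynomial.eval a (MvPolynomial.pderiv i (f k)) := by
    intro a ha
    refine linearIndependent_of_forall_dotProduct fun h => ?_
    -- A direction realising a prescribed derivative realises prescribed pairings with all the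
    -- gradients, which makes them independent.
    obtain ⟨v, hv⟩ := hD (b.equivFun.symm a) ((hF0 _).2
      (by simpa only [LinearEquiv.apply_symm_apply] using ha)) (c.equivFun.symm h)
    refine ⟨b.equivFun v, fun k => ?_⟩
    have h1 := hv (c.coord k)
    simp only [hf, map_add, map_smul, LinearEquiv.apply_symm_apply] at h1
    have h2 := (MvPolynomial.hasDerivAt_eval_line a (b.equivFun v) (f k)).unique h1
    rw [h2]
    exact congrFun (c.equivFun.apply_symm_apply h) k
  have hcard : Module.finrank ℂ H ≤ Module.finrank ℂ E := by
    obtain ⟨z, hz⟩ := hne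
    have h := (hg _ ((hF0 z).1 hz)).fintype_card_le_finrank
    simpa using h
  refine ⟨Module.finrank ℂ E - Module.finrank ℂ H, ?_, by omega⟩
  rw [topologicalKrullDim_zariski b _ (Ideal.span (range f))]
  · have h := MvPolynomial.ringKrullDim_quotient_span f
      (hne.imp' b.equivFun fun z hz => (hF0 z).1 hz) hg
    simpa using h
  · intro z
    rw [mem_ofPred_eq, hF0]
    refine ⟨fun h p hp => ?_, fun h k => h _ (Ideal.subset_span ⟨k, rfl⟩)⟩
    have hle : Ideal.span (range f) ≤ RingHom.ker (MvPolynomial.eval (b.equivFun z)) := by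
      rw [Ideal.span_le]
      rintro _ ⟨k, rfl⟩
      exact h k
    exact hle hp

/-- A space covered by open subspaces of dimension `d` has dimension `d`. -/
theorem topologicalKrullDim_eq_of_cover {X : Type*} [TopologicalSpace X] [Nonempty X] (d : ℕ)
    (h : ∀ x : X, ∃ (Y : Type*) (_ : TopologicalSpace Y) (f : Y → X), IsOpenEmbedding f ∧
      x ∈ range f ∧ topologicalKrullDim Y = d) : topologicalKrullDim X = d := by
  apply le_antisymm
  · rw [topologicalKrullDim, Order.krullDim_eq_iSup_coheight, iSup_le_iff]
    intro V
    obtain ⟨x, hx⟩ := V.isIrreducible.nonempty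
    obtain ⟨Y, _, f, hf, ⟨y, rfl⟩, hd⟩ := h x
    -- Every irreducible closed set containing `V` also meets the chart around `x`, so the coheight
    -- of `V` can be computed inside the chart.
    obtain ⟨T, hT⟩ :=
      (TopologicalSpace.IrreducibleCloseds.orderIsoOfIsOpenEmbedding f hf).surjective ⟨V, y, hx⟩
    have hV : TopologicalSpace.IrreducibleCloseds.map f hf.continuous T = V :=
      congrArg Subtype.val hT
    rw [← hV, hf.coheight_map, ← hd]
    exact Order.coheight_le_krullDim T
  · obtain ⟨Y, _, f, hf, -, hd⟩ := h (Classical.arbitrary X)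
    rw [← hd]
    exact hf.isInducing.topologicalKrullDim_le


/-! ### The trace argument -/

section TraceArgument

variable {W : Type*} [AddCommGroup W] [Module ℂ W] [FiniteDimensional ℂ W]

/-- A commutator has trace zero, so the trace of the identity, which is the dimension, vanishes in
characteristic zero. -/
theorem subsingleton_of_commutator_add_one {A B : Module.End ℂ W} (h : A * B - B * A + 1 = 0) :
    Subsingleton W := by
  have h1 := congrArg (LinearMap.trace ℂ W) h
  rw [map_add, map_sub, LinearMap.trace_mul_comm, sub_self, zero_add, LinearMap.trace_one,
    map_zero] at h1
  exact Module.finrank_zero_iff.1 (by exact_mod_cast h1)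

/-- A stable subspace containing the image of the commutator defect is everything. -/
theorem eq_top_of_commutator {A B R : Module.End ℂ W} (h : A * B - B * A + 1 = R)
    (N : Submodule ℂ W) (hA : ∀ u ∈ N, A u ∈ N) (hB : ∀ u ∈ N, B u ∈ N) (hR : ∀ u, R u ∈ N) :
    N = ⊤ := by
  have h1 : (N.mapQ N A hA) * (N.mapQ N B hB) - (N.mapQ N B hB) * (N.mapQ N A hA) + 1 = 0 := by
    apply Submodule.linearMap_qext
    ext u
    have h2 := LinearMap.congr_fun h u
    simp only [LinearMap.add_apply, LinearMap.sub_apply, Module.End.mul_apply,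
      Module.End.one_apply] at h2
    simp only [LinearMap.comp_apply, LinearMap.add_apply, LinearMap.sub_apply,
      Module.End.mul_apply, Module.End.one_apply, Submodule.mkQ_apply, Submodule.mapQ_apply,
      LinearMap.zero_apply]
    rw [← Submodule.Quotient.mk_sub, ← Submodule.Quotient.mk_add, h2,
      Submodule.Quotient.mk_eq_zero]
    exact hR u
  have := subsingleton_of_commutator_add_one h1
  exact Submodule.Quotient.subsingleton_iff.1 this

/-- A stable subspace in the kernel of the commutator defect is zero. -/
theorem eq_bot_of_commutator {A B R : Module.End ℂ W} (h : A * B - B * A + 1 = R)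
    (N : Submodule ℂ W) (hA : ∀ u ∈ N, A u ∈ N) (hB : ∀ u ∈ N, B u ∈ N) (hR : ∀ u ∈ N, R u = 0) :
    N = ⊥ := by
  have h1 : (A.restrict hA) * (B.restrict hB) - (B.restrict hB) * (A.restrict hA) + 1 = 0 := by
    ext u
    have h2 := LinearMap.congr_fun h u
    rw [hR u u.2] at h2
    simpa using h2
  have := subsingleton_of_commutator_add_one h1
  exact Submodule.subsingleton_iff_eq_bot.1 this

end TraceArgument

/-! ### Block matrices, the path algebra and separation of orbits -/

section BigMatrices

variable {m : ℕ} {V : ZMod m → Type*} [∀ i, AddCommGroup (V i)] [∀ i, Module ℂ (V i)]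
  {n : ZMod m}

/-- A linear automorphism that commutes with the projections is block-diagonal. -/
theorem exists_diagonal (T : (∀ i, V i) ≃ₗ[ℂ] (∀ i, V i))
    (hT : ∀ (l : ZMod m) (u : ∀ i, V i), T (Pi.single l (u l)) = Pi.single l (T u l)) :
    ∃ a : ∀ i, V i ≃ₗ[ℂ] V i, ∀ u, T u = fun i => a i (u i) := by
  have hTsymm : ∀ (l : ZMod m) (u : ∀ i, V i),
      T.symm (Pi.single l (u l)) = Pi.single l (T.symm u l) := by
    intro l u
    rw [LinearEquiv.symm_apply_eq, hT, T.apply_symm_apply]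
  refine ⟨fun l => LinearEquiv.ofLinearMap
    (LinearMap.proj l ∘ₗ T.toLinearMap ∘ₗ LinearMap.single ℂ V l)
    (LinearMap.proj l ∘ₗ T.symm.toLinearMap ∘ₗ LinearMap.single ℂ V l)
    (by
      ext v
      simp [← hTsymm l (Pi.single l v)])
    (by
      ext v
      simp [← hT l (Pi.single l v)]), fun u => ?_⟩
  ext i
  change _ = T (Pi.single i (u i)) i
  rw [hT, Pi.single_eq_same]

namespace CyclicQuad

/-- The vector `i_n(1)`, extended by zero. -/
def bigI : CyclicQuad V n →ₗ[ℂ] (∀ i, V i) :=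
  LinearMap.single ℂ V n ∘ₗ LinearMap.applyₗ (1 : ℂ) ∘ₗ LinearMap.fst ℂ _ _ ∘ₗ
    LinearMap.snd ℂ _ _ ∘ₗ LinearMap.snd ℂ _ _

/-- The functional `j_n`, extended by zero. -/
def bigJ : CyclicQuad V n →ₗ[ℂ] Module.Dual ℂ (∀ i, V i) :=
  LinearMap.lcomp ℂ ℂ (LinearMap.proj n) ∘ₗ LinearMap.snd ℂ _ _ ∘ₗ
    LinearMap.snd ℂ _ _ ∘ₗ LinearMap.snd ℂ _ _

theorem bigI_def (q : CyclicQuad V n) : bigI q = Pi.single n (q.2.2.1 1) := rfl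

theorem bigJ_apply (q : CyclicQuad V n) (u : ∀ i, V i) : bigJ q u = q.2.2.2 (u n) := rfl

theorem eq_cyclicAct_iff {a : ∀ i, V i ≃ₗ[ℂ] V i} {x y : CyclicQuad V n} :
    y = cyclicAct a x ↔ (∀ l v, y.1 l (a (l + 1) v) = a l (x.1 l v)) ∧
      (∀ l v, y.2.1 l (a l v) = a (l + 1) (x.2.1 l v)) ∧ y.2.2.1 1 = a n (x.2.2.1 1) ∧
      ∀ v, y.2.2.2 (a n v) = x.2.2.2 v := by
  constructor
  · rintro rfl
    refine ⟨fun l v => ?_, fun l v => ?_, ?_, fun v => ?_⟩ <;> simp [cyclicAct]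
  · rintro ⟨h1, h2, h3, h4⟩
    refine Prod.ext ?_ (Prod.ext ?_ (Prod.ext ?_ ?_))
    · ext l v
      simpa [cyclicAct] using h1 l ((a (l + 1)).symm v)
    · ext l v
      simpa [cyclicAct] using h2 l ((a l).symm v)
    · ext
      simpa [cyclicAct] using h3
    · ext v
      simpa [cyclicAct] using h4 ((a n).symm v)

theorem bigI_cyclicAct (a : ∀ i, V i ≃ₗ[ℂ] V i) (x : CyclicQuad V n) :
    bigI (cyclicAct a x) = fun i => a i (bigI x i) := by
  ext i
  rw [bigI_def, bigI_def]
  by_cases h : i = n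
  · subst h
    simp [cyclicAct]
  · simp [h]

theorem bigJ_cyclicAct (a : ∀ i, V i ≃ₗ[ℂ] V i) (x : CyclicQuad V n) (u : ∀ i, V i) :
    bigJ (cyclicAct a x) (fun i => a i (u i)) = bigJ x u := by
  rw [bigJ_apply, bigJ_apply]
  simp [cyclicAct]

variable [NeZero m]

/-- The block-cyclic endomorphism with blocks `X_l`. -/
def bigX : CyclicQuad V n →ₗ[ℂ] Module.End ℂ (∀ i, V i) where
  toFun q := ∑ l, LinearMap.single ℂ V l ∘ₗ q.1 l ∘ₗ LinearMap.proj (l + 1)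
  map_add' q r := by
    simp [LinearMap.comp_add, LinearMap.add_comp, Finset.sum_add_distrib]
  map_smul' c q := by
    simp [LinearMap.comp_smul, LinearMap.smul_comp, Finset.smul_sum]

/-- The block-cyclic endomorphism with blocks `Y_l`. -/
def bigY : CyclicQuad V n →ₗ[ℂ] Module.End ℂ (∀ i, V i) where
  toFun q := ∑ l, LinearMap.single ℂ V (l + 1) ∘ₗ q.2.1 l ∘ₗ LinearMap.proj l
  map_add' q r := by
    simp [LinearMap.comp_add, LinearMap.add_comp, Finset.sum_add_distrib]
  map_smul' c q := by
    simp [LinearMap.comp_smul, LinearMap.smul_comp, Finset.smul_sum]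

theorem bigX_apply (q : CyclicQuad V n) (u : ∀ i, V i) (l : ZMod m) :
    bigX q u l = q.1 l (u (l + 1)) := by
  simp only [bigX, LinearMap.coe_mk, AddHom.coe_mk, LinearMap.sum_apply, LinearMap.comp_apply,
    LinearMap.proj_apply, LinearMap.single_apply, Finset.sum_apply]
  rw [Finset.sum_eq_single l]
  · simp
  · intro k _ hk
    rw [Pi.single_eq_of_ne hk.symm]
  · simp

theorem bigY_apply (q : CyclicQuad V n) (u : ∀ i, V i) (l : ZMod m) :
    bigY q u (l + 1) = q.2.1 l (u l) := by
  simp only [bigY, LinearMap.coe_mk, AddHom.coe_mk, LinearMap.sum_apply, LinearMap.comp_apply,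
    LinearMap.proj_apply, LinearMap.single_apply, Finset.sum_apply]
  rw [Finset.sum_eq_single l]
  · simp
  · intro k _ hk
    rw [Pi.single_eq_of_ne fun h => hk (add_right_cancel h).symm]
  · simp

theorem bigX_single (q : CyclicQuad V n) (l : ZMod m) (v : V (l + 1)) :
    bigX q (Pi.single (l + 1) v) = Pi.single l (q.1 l v) := by
  ext k
  rw [bigX_apply]
  by_cases h : k = l
  · subst h
    simp
  · rw [Pi.single_eq_of_ne h, Pi.single_eq_of_ne fun h' => h (add_right_cancel h'), map_zero]

theorem bigY_single (q : CyclicQuad V n) (l : ZMod m) (v : V l) :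
    bigY q (Pi.single l v) = Pi.single (l + 1) (q.2.1 l v) := by
  ext k
  obtain ⟨k, rfl⟩ : ∃ k', k = k' + 1 := ⟨k - 1, by ring⟩
  rw [bigY_apply]
  by_cases h : k = l
  · subst h
    simp
  · rw [Pi.single_eq_of_ne h, Pi.single_eq_of_ne fun h' => h (add_right_cancel h'), map_zero]

/-- The defect of the moment map equation. -/
def defect (q : CyclicQuad V n) : Module.End ℂ (∀ i, V i) :=
  bigX q * bigY q - bigY q * bigX q + 1 - (bigJ q).smulRight (bigI q)

theorem defect_apply (q : CyclicQuad V n) (u : ∀ i, V i) (l : ZMod m) :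
    defect q u (l + 1) = (q.1 (l + 1) ∘ₗ q.2.1 (l + 1) - q.2.1 l ∘ₗ q.1 l + LinearMap.id
      - (Pi.single n (q.2.2.1 ∘ₗ q.2.2.2) : ∀ l, V l →ₗ[ℂ] V l) (l + 1) :
        V (l + 1) →ₗ[ℂ] V (l + 1)) (u (l + 1)) := by
  simp only [defect, LinearMap.sub_apply, LinearMap.add_apply, Module.End.mul_apply,
    Module.End.one_apply, Pi.sub_apply, Pi.add_apply, bigX_apply, bigY_apply,
    LinearMap.comp_apply, LinearMap.id_apply, LinearMap.smulRight_apply, bigJ_apply, bigI_def]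
  congr 1
  by_cases h : l + 1 = n
  · subst h
    -- A linear map out of `ℂ` is determined by its value at `1`, so `i_n ∘ j_n` is the rank-one map
    -- `u ↦ j_n(u) • i_n(1)`.
    have := (q.2.2.1).map_smul (q.2.2.2 (u (l + 1))) 1
    simpa using this.symm
  · simp [Pi.single_eq_of_ne h]

/-- The diagonal blocks of the defect of the moment map equation. -/
def moment (q : CyclicQuad V n) (l : ZMod m) : V l →ₗ[ℂ] V l :=
  LinearMap.proj l ∘ₗ defect q ∘ₗ LinearMap.single ℂ V l

theorem moment_apply (q : CyclicQuad V n) (l : ZMod m) (v : V (l + 1)) :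
    moment q (l + 1) v = (q.1 (l + 1) ∘ₗ q.2.1 (l + 1) - q.2.1 l ∘ₗ q.1 l + LinearMap.id
      - (Pi.single n (q.2.2.1 ∘ₗ q.2.2.2) : ∀ l, V l →ₗ[ℂ] V l) (l + 1) :
        V (l + 1) →ₗ[ℂ] V (l + 1)) v := by
  have h := defect_apply q (Pi.single (l + 1) v) l
  rwa [Pi.single_eq_same] at h

theorem mem_cyclicSet_iff_moment {q : CyclicQuad V n} :
    q ∈ cyclicSet V n ↔ ∀ l, moment q l = 0 := by
  have h : q ∈ cyclicSet V n ↔ ∀ l, moment q (l + 1) = 0 := by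
    refine forall_congr' fun l => ?_
    rw [← sub_eq_zero, show moment q (l + 1) = _ from LinearMap.ext (moment_apply q l)]
  rw [h]
  refine ⟨fun H l => ?_, fun H l => H _⟩
  obtain ⟨l, rfl⟩ : ∃ k, l = k + 1 := ⟨l - 1, by ring⟩
  exact H l

/-- The defect is block-diagonal, since `X Y` and `Y X` preserve each `V l` and `i j` lives on `V
n`. The equations at the vertices therefore combine into a single one, to which the trace argument
applies. -/
theorem mem_cyclicSet_iff {q : CyclicQuad V n} :
    q ∈ cyclicSet V n ↔
      bigX q * bigY q - bigY q * bigX q + 1 = (bigJ q).smulRight (bigI q) := by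
  rw [mem_cyclicSet_iff_moment, ← sub_eq_zero]
  change _ ↔ defect q = 0
  constructor
  · intro h
    refine LinearMap.ext fun u => ?_
    ext l
    obtain ⟨l, rfl⟩ : ∃ k, l = k + 1 := ⟨l - 1, by ring⟩
    rw [defect_apply, ← moment_apply, h]
    rfl
  · intro h l
    rw [moment, h]
    ext
    simp

/-- Evaluation of non-commutative polynomials in `X`, `Y` and the projections to the `V_l`. -/
def ev (q : CyclicQuad V n) :
    FreeAlgebra ℂ (Bool ⊕ ZMod m) →ₐ[ℂ] Module.End ℂ (∀ i, V i) :=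
  FreeAlgebra.lift ℂ (Sum.elim (fun c => cond c (bigX q) (bigY q))
    fun l => LinearMap.single ℂ V l ∘ₗ LinearMap.proj l)

@[simp]
theorem ev_X (q : CyclicQuad V n) : ev q (FreeAlgebra.ι ℂ (Sum.inl true)) = bigX q := by
  simp [ev]

@[simp]
theorem ev_Y (q : CyclicQuad V n) : ev q (FreeAlgebra.ι ℂ (Sum.inl false)) = bigY q := by
  simp [ev]

@[simp]
theorem ev_proj (q : CyclicQuad V n) (l : ZMod m) :
    ev q (FreeAlgebra.ι ℂ (Sum.inr l)) = LinearMap.single ℂ V l ∘ₗ LinearMap.proj l := by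
  simp [ev]

/-- The orbit of the vector `i` under the path algebra. -/
def evI (q : CyclicQuad V n) : FreeAlgebra ℂ (Bool ⊕ ZMod m) →ₗ[ℂ] (∀ i, V i) :=
  LinearMap.applyₗ (bigI q) ∘ₗ (ev q).toLinearMap

theorem evI_apply (q : CyclicQuad V n) (p : FreeAlgebra ℂ (Bool ⊕ ZMod m)) :
    evI q p = ev q p (bigI q) := rfl

theorem evI_mul (q : CyclicQuad V n) (p p' : FreeAlgebra ℂ (Bool ⊕ ZMod m)) :
    evI q (p * p') = ev q p (evI q p') := by
  simp [evI_apply]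

theorem evI_one (q : CyclicQuad V n) : evI q 1 = bigI q := by
  simp [evI_apply]

theorem ev_cyclicAct (a : ∀ i, V i ≃ₗ[ℂ] V i) (x : CyclicQuad V n)
    (p : FreeAlgebra ℂ (Bool ⊕ ZMod m)) (u : ∀ i, V i) :
    ev (cyclicAct a x) p (fun i => a i (u i)) = fun i => a i (ev x p u i) := by
  obtain ⟨h1, h2, -, -⟩ := eq_cyclicAct_iff.1 (rfl : cyclicAct a x = cyclicAct a x)
  induction p using FreeAlgebra.induction generalizing u with
  | grade0 r =>
    ext i
    simp [Algebra.algebraMap_eq_smul_one]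
  | grade1 s =>
    rcases s with (_ | _) | k
    · ext i
      obtain ⟨i, rfl⟩ : ∃ k, i = k + 1 := ⟨i - 1, by ring⟩
      rw [ev_Y, ev_Y, bigY_apply, bigY_apply, h2]
    · ext i
      rw [ev_X, ev_X, bigX_apply, bigX_apply, h1]
    · ext i
      rw [ev_proj, ev_proj]
      by_cases h : i = k
      · subst h
        simp
      · simp [h]
  | mul p p' hp hp' => simp only [map_mul, Module.End.mul_apply, hp', hp]
  | add p p' hp hp' =>
    ext i
    simp only [map_add, LinearMap.add_apply, hp', hp, Pi.add_apply]

theorem evI_cyclicAct (a : ∀ i, V i ≃ₗ[ℂ] V i) (x : CyclicQuad V n)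
    (p : FreeAlgebra ℂ (Bool ⊕ ZMod m)) :
    evI (cyclicAct a x) p = fun i => a i (evI x p i) := by
  rw [evI_apply, bigI_cyclicAct, ev_cyclicAct, evI_apply]

theorem cyclicAct_mem (a : ∀ i, V i ≃ₗ[ℂ] V i) {x : CyclicQuad V n} (hx : x ∈ cyclicSet V n) :
    cyclicAct a x ∈ cyclicSet V n := by
  rw [mem_cyclicSet_iff] at hx ⊢
  refine LinearMap.ext fun u => ?_
  obtain ⟨w, rfl⟩ : ∃ w : ∀ i, V i, u = fun i => a i (w i) :=
    ⟨fun i => (a i).symm (u i), by simp⟩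
  have h := ev_cyclicAct a x
  have hX := h (FreeAlgebra.ι ℂ (Sum.inl true))
  have hY := h (FreeAlgebra.ι ℂ (Sum.inl false))
  simp only [ev_X, ev_Y] at hX hY
  have hw := LinearMap.congr_fun hx w
  simp only [LinearMap.add_apply, LinearMap.sub_apply, Module.End.mul_apply,
    Module.End.one_apply, LinearMap.smulRight_apply, hX, hY, bigJ_cyclicAct,
    bigI_cyclicAct] at hw ⊢
  ext i
  have hi := congrArg (a i) (congrFun hw i)
  simpa using hi

variable [∀ i, FiniteDimensional ℂ (V i)]

/-- The vectors `p i` form a subspace stable under `X` and `Y` that contains the image of the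
rank-one term, so the trace argument on the quotient applies. -/
theorem evI_surjective {q : CyclicQuad V n} (hq : q ∈ cyclicSet V n) :
    Function.Surjective (evI q) := by
  rw [← LinearMap.range_eq_top]
  refine eq_top_of_commutator (mem_cyclicSet_iff.1 hq) _ ?_ ?_ ?_
  · rintro _ ⟨p, rfl⟩
    exact ⟨FreeAlgebra.ι ℂ (Sum.inl true) * p, by rw [evI_mul, ev_X]⟩
  · rintro _ ⟨p, rfl⟩
    exact ⟨FreeAlgebra.ι ℂ (Sum.inl false) * p, by rw [evI_mul, ev_Y]⟩
  · intro u
    exact Submodule.smul_mem _ _ ⟨1, evI_one q⟩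

/-- The dual statement: the vectors invisible to all `j p` form a stable subspace on which the
rank-one term vanishes. -/
theorem eq_zero_of_forall_bigJ_ev {q : CyclicQuad V n} (hq : q ∈ cyclicSet V n) {u : ∀ i, V i}
    (hu : ∀ p, bigJ q (ev q p u) = 0) : u = 0 := by
  let N : Submodule ℂ (∀ i, V i) :=
    { carrier := {u | ∀ p, bigJ q (ev q p u) = 0}
      add_mem' := fun ha hb p => by rw [map_add, map_add, ha, hb, add_zero]
      zero_mem' := fun p => by rw [map_zero, map_zero]
      smul_mem' := fun c x hx p => by rw [map_smul, map_smul, hx, smul_zero] }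
  have hN : N = ⊥ := by
    refine eq_bot_of_commutator (mem_cyclicSet_iff.1 hq) _ ?_ ?_ ?_
    · intro u hu p
      have h : bigJ q (ev q (p * FreeAlgebra.ι ℂ (Sum.inl true)) u) = 0 := hu _
      rwa [map_mul, ev_X] at h
    · intro u hu p
      have h : bigJ q (ev q (p * FreeAlgebra.ι ℂ (Sum.inl false)) u) = 0 := hu _
      rwa [map_mul, ev_Y] at h
    · intro u hu
      have h := hu 1
      rw [map_one, Module.End.one_apply] at h
      rw [LinearMap.smulRight_apply, h, zero_smul]
  have hu' : u ∈ N := hu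
  rwa [hN, Submodule.mem_bot] at hu'

/-- The functions `j p(X, Y) i` separate the orbits. -/
theorem exists_eq_cyclicAct {x y : CyclicQuad V n} (hx : x ∈ cyclicSet V n)
    (hy : y ∈ cyclicSet V n) (h : ∀ p, bigJ x (evI x p) = bigJ y (evI y p)) :
    ∃ a, y = cyclicAct a x := by
  -- By cogeneration, `p i = 0` exactly when `j r p i = 0` for all `r`. Equal invariants thus give
  -- equal annihilators of `i`, and both representations are the same quotient of the path algebra.
  have hker : ∀ x y : CyclicQuad V n, y ∈ cyclicSet V n →
      (∀ p, bigJ x (evI x p) = bigJ y (evI y p)) →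
      LinearMap.ker (evI x) ≤ LinearMap.ker (evI y) := by
    intro x y hy h p hp
    rw [LinearMap.mem_ker] at hp ⊢
    refine eq_zero_of_forall_bigJ_ev hy fun r => ?_
    rw [← evI_mul, ← h, evI_mul, hp, map_zero, map_zero]
  have hk : LinearMap.ker (evI x) = LinearMap.ker (evI y) :=
    le_antisymm (hker x y hy h) (hker y x hx fun p => (h p).symm)
  let T : (∀ i, V i) ≃ₗ[ℂ] (∀ i, V i) :=
    ((evI x).quotKerEquivOfSurjective (evI_surjective hx)).symm ≪≫ₗ
      Submodule.quotEquivOfEq _ _ hk ≪≫ₗ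
      (evI y).quotKerEquivOfSurjective (evI_surjective hy)
  have hT : ∀ p, T (evI x p) = evI y p := by
    intro p
    have : ((evI x).quotKerEquivOfSurjective (evI_surjective hx)).symm (evI x p)
        = Submodule.Quotient.mk p := by
      rw [LinearEquiv.symm_apply_eq]
      rfl
    simp only [T, LinearEquiv.trans_apply, this]
    rfl
  have hTev : ∀ p u, T (ev x p u) = ev y p (T u) := by
    intro p u
    obtain ⟨r, rfl⟩ := evI_surjective hx u
    rw [← evI_mul, hT, hT, evI_mul]
  -- The projections belong to the path algebra; this is what makes `T` block-diagonal, hence an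
  -- element of `∏ GL(V_l)`.
  have hTproj : ∀ (l : ZMod m) (u : ∀ i, V i), T (Pi.single l (u l)) = Pi.single l (T u l) := by
    intro l u
    simpa using hTev (FreeAlgebra.ι ℂ (Sum.inr l)) u
  obtain ⟨a, hTa⟩ := exists_diagonal T hTproj
  have hJ : ∀ u, bigJ y (T u) = bigJ x u := by
    intro u
    obtain ⟨r, rfl⟩ := evI_surjective hx u
    rw [hT, h]
  have hTs : ∀ l (v : V l), T (Pi.single l v) = Pi.single l (a l v) := by
    intro l v
    have := hTproj l (Pi.single l v)
    simp only [hTa, Pi.single_eq_same] at this ⊢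
    exact this
  refine ⟨a, eq_cyclicAct_iff.2 ⟨fun l v => ?_, fun l v => ?_, ?_, fun v => ?_⟩⟩
  · have h1 := hTev (FreeAlgebra.ι ℂ (Sum.inl true)) (Pi.single (l + 1) v)
    rw [ev_X, ev_X, bigX_single, hTs, hTs, bigX_single] at h1
    exact (Pi.single_injective l h1).symm
  · have h1 := hTev (FreeAlgebra.ι ℂ (Sum.inl false)) (Pi.single l v)
    rw [ev_Y, ev_Y, bigY_single, hTs, hTs, bigY_single] at h1
    exact (Pi.single_injective _ h1).symm
  · have h1 := hT 1
    rw [evI_one, evI_one, bigI_def, bigI_def, hTs] at h1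
    exact (Pi.single_injective n h1).symm
  · have h1 := hJ (Pi.single n v)
    rw [hTs, bigJ_apply, bigJ_apply, Pi.single_eq_same, Pi.single_eq_same] at h1
    exact h1

end CyclicQuad

end BigMatrices


/-! ### The trace pairing -/

section TracePairing

variable {W W' : Type*} [AddCommGroup W] [Module ℂ W] [FiniteDimensional ℂ W]
  [AddCommGroup W'] [Module ℂ W'] [FiniteDimensional ℂ W']

theorem trace_comp_smulRight (A : W →ₗ[ℂ] W) (f : Module.Dual ℂ W) (w : W) :
    LinearMap.trace ℂ W (A * f.smulRight w) = f (A w) := by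
  have : A * f.smulRight w = f.smulRight (A w) := by
    ext u
    simp
  rw [this, LinearMap.trace_smulRight]

/-- The trace form is nondegenerate, as rank-one endomorphisms detect every matrix entry; equality
of dimensions then gives surjectivity. -/
theorem exists_eq_trace_mul (φ : Module.Dual ℂ (W →ₗ[ℂ] W)) :
    ∃ ξ : Module.End ℂ W, ∀ A : Module.End ℂ W, φ A = LinearMap.trace ℂ W (ξ * A) := by
  let T : Module.End ℂ W →ₗ[ℂ] Module.Dual ℂ (W →ₗ[ℂ] W) :=
    (LinearMap.llcomp ℂ _ _ _ (LinearMap.trace ℂ W)) ∘ₗ LinearMap.mul ℂ (Module.End ℂ W)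
  have hT : Function.Injective T := by
    rw [injective_iff_map_eq_zero]
    intro ξ hξ
    ext w
    rw [LinearMap.zero_apply, ← Module.forall_dual_apply_eq_zero_iff ℂ]
    intro f
    rw [← trace_comp_smulRight]
    exact LinearMap.congr_fun hξ (f.smulRight w)
  have hs := (LinearMap.injective_iff_surjective_of_finrank_eq_finrank
    (Subspace.dual_finrank_eq (K := ℂ) (V := W →ₗ[ℂ] W)).symm).1 hT
  obtain ⟨ξ, rfl⟩ := hs φ
  exact ⟨ξ, fun A => rfl⟩

end TracePairing

/-! ### Infinitesimal action and submersivity of the moment map -/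

namespace CyclicQuad

variable {m : ℕ} {V : ZMod m → Type*} [∀ i, AddCommGroup (V i)] [∀ i, Module ℂ (V i)]
  {n : ZMod m}

theorem bigI_eq_zero {q : CyclicQuad V n} (h : q.2.2.1 = 0) : bigI q = 0 := by
  simp [bigI_def, h]

theorem bigJ_eq_zero {q : CyclicQuad V n} (h : q.2.2.2 = 0) : bigJ q = 0 := by
  refine LinearMap.ext fun u => ?_
  simp [bigJ_apply, h]

variable [NeZero m]

/-- The block-diagonal endomorphism with blocks `ξ_l`. -/
def diag (ξ : ∀ l, V l →ₗ[ℂ] V l) : Module.End ℂ (∀ i, V i) :=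
  ∑ l, LinearMap.single ℂ V l ∘ₗ ξ l ∘ₗ LinearMap.proj l

theorem diag_apply (ξ : ∀ l, V l →ₗ[ℂ] V l) (u : ∀ i, V i) (l : ZMod m) :
    diag ξ u l = ξ l (u l) := by
  simp only [diag, LinearMap.sum_apply, LinearMap.comp_apply,
    LinearMap.proj_apply, LinearMap.single_apply, Finset.sum_apply]
  rw [Finset.sum_eq_single l]
  · simp
  · intro k _ hk
    rw [Pi.single_eq_of_ne hk.symm]
  · simp

theorem diag_single (ξ : ∀ l, V l →ₗ[ℂ] V l) (l : ZMod m) (v : V l) :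
    diag ξ (Pi.single l v) = Pi.single l (ξ l v) := by
  ext k
  rw [diag_apply]
  by_cases h : k = l
  · subst h
    simp
  · simp [h]

/-- The derivative of the moment map at `z` in the direction `v`, as a block matrix. -/
def momentDeriv (z v : CyclicQuad V n) : Module.End ℂ (∀ i, V i) :=
  bigX v * bigY z + bigX z * bigY v - (bigY v * bigX z + bigY z * bigX v)
    - ((bigJ v).smulRight (bigI z) + (bigJ z).smulRight (bigI v))

/-- The defect is quadratic, so its expansion along a line is exact and the derivative is read off
from the coefficient of `t`. -/
theorem defect_line (z v : CyclicQuad V n) (t : ℂ) :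
    defect (z + t • v) = defect z + t • (momentDeriv z v
      + t • (bigX v * bigY v - bigY v * bigX v - (bigJ v).smulRight (bigI v))) := by
  have h : ∀ (f g : Module.Dual ℂ (∀ i, V i)) (u w : ∀ i, V i),
      (f + t • g).smulRight (u + t • w) = f.smulRight u + t • (g.smulRight u + f.smulRight w)
        + (t * t) • g.smulRight w := by
    intro f g u w
    refine LinearMap.ext fun x => ?_
    simp only [LinearMap.smulRight_apply, LinearMap.add_apply, LinearMap.smul_apply, smul_eq_mul]
    module
  simp only [defect, momentDeriv, map_add, map_smul, h, add_mul, mul_add, smul_mul_assoc,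
    mul_smul_comm, smul_smul, smul_add, smul_sub]
  abel

theorem hasWeakDeriv_moment (z v : CyclicQuad V n) (l : ZMod m) :
    HasWeakDeriv (fun t => moment (z + t • v) l)
      (LinearMap.proj l ∘ₗ momentDeriv z v ∘ₗ LinearMap.single ℂ V l) := by
  have h : HasWeakDeriv (fun t => defect (z + t • v)) (momentDeriv z v) := by
    simp only [defect_line]
    simpa using (hasWeakDeriv_const (defect z)).add
      (hasWeakDeriv_affine (momentDeriv z v) _).smul_id
  exact h.linear_comp (LinearMap.llcomp ℂ _ _ _ (LinearMap.proj l) ∘ₗ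
    LinearMap.lcomp ℂ _ (LinearMap.single ℂ V l))

section InfinitesimalAction

/-- The infinitesimal action of `ξ ∈ ∏ gl(V_l)` at `z`. -/
def infAct (ξ : ∀ l, V l →ₗ[ℂ] V l) (z : CyclicQuad V n) : CyclicQuad V n :=
  (fun l => ξ l ∘ₗ z.1 l - z.1 l ∘ₗ ξ (l + 1), fun l => ξ (l + 1) ∘ₗ z.2.1 l - z.2.1 l ∘ₗ ξ l,
    ξ n ∘ₗ z.2.2.1, -(z.2.2.2 ∘ₗ ξ n))

variable (ξ : ∀ l, V l →ₗ[ℂ] V l) (z : CyclicQuad V n)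

theorem bigX_infAct : bigX (infAct ξ z) = diag ξ * bigX z - bigX z * diag ξ := by
  refine LinearMap.ext fun u => ?_
  ext l
  simp [bigX_apply, diag_apply, infAct]

theorem bigY_infAct : bigY (infAct ξ z) = diag ξ * bigY z - bigY z * diag ξ := by
  refine LinearMap.ext fun u => ?_
  ext l
  obtain ⟨l, rfl⟩ : ∃ k, l = k + 1 := ⟨l - 1, by ring⟩
  simp [bigY_apply, diag_apply, infAct]

theorem bigI_infAct : bigI (infAct ξ z) = diag ξ (bigI z) := by
  rw [bigI_def, bigI_def, diag_single]
  rfl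

theorem bigJ_infAct : bigJ (infAct ξ z) = -(bigJ z ∘ₗ diag ξ) := by
  refine LinearMap.ext fun u => ?_
  rw [LinearMap.neg_apply, LinearMap.comp_apply, bigJ_apply, bigJ_apply, diag_apply]
  rfl

/-- The moment map is equivariant, so its zero set is preserved to first order along orbits.
Concretely, replacing the rank-one term by `X Y - Y X + 1` makes all commutators with `diag ξ`
cancel. -/
theorem momentDeriv_infAct {z : CyclicQuad V n} (hz : z ∈ cyclicSet V n) :
    momentDeriv z (infAct ξ z) = 0 := by
  have h1 : (bigJ (infAct ξ z)).smulRight (bigI z)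
      = -((bigJ z).smulRight (bigI z) * diag ξ : Module.End ℂ (∀ i, V i)) := by
    rw [bigJ_infAct]
    refine LinearMap.ext fun u => ?_
    simp
  have h2 : (bigJ z).smulRight (bigI (infAct ξ z))
      = (diag ξ * (bigJ z).smulRight (bigI z) : Module.End ℂ (∀ i, V i)) := by
    rw [bigI_infAct]
    refine LinearMap.ext fun u => ?_
    simp
  rw [momentDeriv, h1, h2, ← mem_cyclicSet_iff.1 hz, bigX_infAct, bigY_infAct]
  simp only [mul_sub, sub_mul, mul_add, add_mul, mul_one, one_mul, mul_assoc]
  abel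

/-- The vector `c t` must move as well: in a product, the inner factor produces a curve whose
derivative is again `diag ξ` of its value at `0`, which closes the induction. -/
theorem hasWeakDeriv_ev_infAct (p : FreeAlgebra ℂ (Bool ⊕ ZMod m)) {c : ℂ → ∀ i, V i}
    (hc : HasWeakDeriv c (diag ξ (c 0))) :
    HasWeakDeriv (fun t => ev (z + t • infAct ξ z) p (c t)) (diag ξ (ev z p (c 0))) := by
  induction p using FreeAlgebra.induction generalizing c with
  | grade0 r =>
    simp only [Algebra.algebraMap_eq_smul_one, map_smul, map_one, LinearMap.smul_apply,
      Module.End.one_apply]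
    exact hc.linear_comp (r • LinearMap.id)
  | grade1 s =>
    rcases s with (_ | _) | k
    · simp only [ev_Y, map_add, map_smul, bigY_infAct]
      convert! hc.affine_apply (bigY z) (diag ξ * bigY z - bigY z * diag ξ) using 1
      simp
    · simp only [ev_X, map_add, map_smul, bigX_infAct]
      convert! hc.affine_apply (bigX z) (diag ξ * bigX z - bigX z * diag ξ) using 1
      simp
    · simp only [ev_proj]
      convert! hc.linear_comp (LinearMap.single ℂ V k ∘ₗ LinearMap.proj k) using 1
      simp [diag_single, diag_apply]
  | mul p p' hp hp' =>
    simp only [map_mul, Module.End.mul_apply]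
    have h := hp' hc
    convert! hp (c := fun t => ev (z + t • infAct ξ z) p' (c t)) ?_ using 1
    · simp
    · simpa using h
  | add p p' hp hp' =>
    simp only [map_add, LinearMap.add_apply]
    exact (hp hc).add (hp' hc)

theorem hasWeakDeriv_evI_infAct (p : FreeAlgebra ℂ (Bool ⊕ ZMod m)) :
    HasWeakDeriv (fun t => evI (z + t • infAct ξ z) p) (diag ξ (evI z p)) := by
  have h : HasWeakDeriv (fun t : ℂ => bigI (z + t • infAct ξ z))
      (diag ξ (bigI (z + (0 : ℂ) • infAct ξ z))) := by
    simp only [map_add, map_smul, bigI_infAct]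
    simpa using hasWeakDeriv_affine (bigI z) (diag ξ (bigI z))
  simpa [evI_apply] using hasWeakDeriv_ev_infAct ξ z p h

end InfinitesimalAction

section TestDirections

theorem bigX_eq_zero {q : CyclicQuad V n} (h : q.1 = 0) : bigX q = 0 := by
  simp [bigX, h]

theorem bigY_eq_zero {q : CyclicQuad V n} (h : q.2.1 = 0) : bigY q = 0 := by
  simp [bigY, h]

theorem bigX_single_smulRight (l : ZMod m) (f : Module.Dual ℂ (V (l + 1))) (w : V l) :
    bigX ((Pi.single l (f.smulRight w), 0, 0, 0) : CyclicQuad V n)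
      = (f ∘ₗ LinearMap.proj (l + 1)).smulRight (Pi.single l w) := by
  refine LinearMap.ext fun u => ?_
  ext k
  rw [bigX_apply]
  by_cases h : k = l
  · subst h
    simp
  · simp [h]

theorem bigY_single_smulRight (l : ZMod m) (f : Module.Dual ℂ (V l)) (w : V (l + 1)) :
    bigY ((0, Pi.single l (f.smulRight w), 0, 0) : CyclicQuad V n)
      = (f ∘ₗ LinearMap.proj l).smulRight (Pi.single (l + 1) w) := by
  refine LinearMap.ext fun u => ?_
  ext k
  obtain ⟨k, rfl⟩ : ∃ k', k = k' + 1 := ⟨k - 1, by ring⟩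
  rw [bigY_apply]
  by_cases h : k = l
  · subst h
    simp
  · simp [h]

end TestDirections

variable [∀ i, FiniteDimensional ℂ (V i)]

theorem trace_diag_mul (ξ : ∀ l, V l →ₗ[ℂ] V l) (A : Module.End ℂ (∀ i, V i)) :
    LinearMap.trace ℂ _ (diag ξ * A) = ∑ l, LinearMap.trace ℂ (V l)
      (ξ l * (LinearMap.proj l ∘ₗ A ∘ₗ LinearMap.single ℂ V l)) := by
  rw [diag, Finset.sum_mul, map_sum]
  refine Finset.sum_congr rfl fun l _ => ?_
  exact (LinearMap.trace_comp_comm' (LinearMap.single ℂ V l) (ξ l ∘ₗ LinearMap.proj l ∘ₗ A)).symm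

/-- The action is infinitesimally free: `diag ξ` commutes with the path algebra and kills the
generating vector. -/
theorem diag_eq_zero_of_commute {z : CyclicQuad V n}
    (hz : z ∈ cyclicSet V n) {ξ : ∀ l, V l →ₗ[ℂ] V l}
    (hX : diag ξ * bigX z = bigX z * diag ξ) (hY : diag ξ * bigY z = bigY z * diag ξ)
    (hI : diag ξ (bigI z) = 0) : ξ = 0 := by
  have hev : ∀ p u, diag ξ (ev z p u) = ev z p (diag ξ u) := by
    intro p
    induction p using FreeAlgebra.induction with
    | grade0 r => simp [Algebra.algebraMap_eq_smul_one]
    | grade1 s =>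
      intro u
      rcases s with (_ | _) | k
      · simpa using LinearMap.congr_fun hY u
      · simpa using LinearMap.congr_fun hX u
      · simp [diag_single, diag_apply]
    | mul p p' hp hp' => simp [hp, hp']
    | add p p' hp hp' => simp [hp, hp']
  ext l v
  obtain ⟨p, hp⟩ := evI_surjective hz (Pi.single l v)
  have h1 : diag ξ (Pi.single l v) = 0 := by
    rw [← hp, evI_apply, hev, hI, map_zero]
  rw [diag_single] at h1
  simpa using h1

/-- The moment map is a submersion along its zero set. -/
theorem exists_momentDeriv_eq {z : CyclicQuad V n} (hz : z ∈ cyclicSet V n)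
    (h : ∀ l, V l →ₗ[ℂ] V l) :
    ∃ v, ∀ l, LinearMap.proj l ∘ₗ momentDeriv z v ∘ₗ LinearMap.single ℂ V l = h l := by
  let D : CyclicQuad V n →ₗ[ℂ] (∀ l, V l →ₗ[ℂ] V l) :=
    { toFun := fun v l => LinearMap.proj l ∘ₗ momentDeriv z v ∘ₗ LinearMap.single ℂ V l
      map_add' := by
        intro v w
        ext l x
        simp [momentDeriv]
        module
      map_smul' := by
        intro c v
        ext l x
        simp [momentDeriv, smul_sub, smul_smul, mul_comm] }
  suffices hD : LinearMap.range D = ⊤ by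
    obtain ⟨v, hv⟩ := LinearMap.range_eq_top.1 hD h
    exact ⟨v, fun l => congrFun hv l⟩
  by_contra hne
  obtain ⟨φ, hφ, hle⟩ := Submodule.exists_le_ker_of_lt_top _ (lt_top_iff_ne_top.2 hne)
  apply hφ
  choose ξ hξ using fun l => exists_eq_trace_mul 
    (φ ∘ₗ LinearMap.single ℂ (fun l => V l →ₗ[ℂ] V l) l)
  have hφξ : ∀ g, φ g = ∑ l, LinearMap.trace ℂ (V l) (ξ l * g l) := by
    intro g
    conv_lhs => rw [← Finset.univ_sum_single g, map_sum]
    exact Finset.sum_congr rfl fun l _ => hξ l (g l)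
  -- A functional vanishing on the image of the derivative is the trace pairing with some `ξ`.
  -- Testing it on rank-one directions in `X`, `Y` and `j` shows that `ξ` commutes with `Y`,
  -- commutes with `X`, and kills `i`.
  have hzero : ∀ v, LinearMap.trace ℂ _ (diag ξ * momentDeriv z v) = 0 := by
    intro v
    have h1 : φ (D v) = 0 := hle ⟨v, rfl⟩
    rw [hφξ] at h1
    rw [trace_diag_mul]
    exact h1
  have hcomm : ∀ A R : Module.End ℂ (∀ i, V i),
      LinearMap.trace ℂ _ (diag ξ * (R * A - A * R))
        = LinearMap.trace ℂ _ ((A * diag ξ - diag ξ * A) * R) := by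
    intro A R
    rw [mul_sub, sub_mul, map_sub, map_sub, ← mul_assoc, LinearMap.trace_mul_comm, ← mul_assoc,
      ← mul_assoc]
  have hcomm' : ∀ A R : Module.End ℂ (∀ i, V i),
      LinearMap.trace ℂ _ (diag ξ * (A * R - R * A))
        = LinearMap.trace ℂ _ ((diag ξ * A - A * diag ξ) * R) := by
    intro A R
    have h : LinearMap.trace ℂ _ (A * diag ξ * R) = LinearMap.trace ℂ _ (diag ξ * (R * A)) := by
      rw [mul_assoc, LinearMap.trace_mul_comm, mul_assoc]
    rw [mul_sub, sub_mul, map_sub, map_sub, h, mul_assoc]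
  have hY : diag ξ * bigY z = bigY z * diag ξ := by
    refine LinearMap.pi_ext fun l w => ?_
    rw [Module.End.mul_apply, Module.End.mul_apply, bigY_single, diag_single, diag_single,
      bigY_single]
    congr 1
    rw [eq_comm, ← sub_eq_zero, ← Module.forall_dual_apply_eq_zero_iff ℂ]
    intro f
    have h1 := hzero (Pi.single l (f.smulRight w), 0, 0, 0)
    rw [momentDeriv, bigX_single_smulRight,
      bigY_eq_zero (q := (Pi.single l (f.smulRight w), 0, 0, 0)) rfl,
      bigI_eq_zero (q := (Pi.single l (f.smulRight w), 0, 0, 0)) rfl,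
      bigJ_eq_zero (q := (Pi.single l (f.smulRight w), 0, 0, 0)) rfl] at h1
    simp only [mul_zero, zero_mul, add_zero, zero_add, LinearMap.smulRight_zero,
      LinearMap.zero_smulRight, sub_zero] at h1
    rw [hcomm, trace_comp_smulRight] at h1
    simpa [bigY_single, diag_single] using h1
  have hX : diag ξ * bigX z = bigX z * diag ξ := by
    refine LinearMap.pi_ext fun l w => ?_
    obtain ⟨l, rfl⟩ : ∃ k, l = k + 1 := ⟨l - 1, by ring⟩
    rw [Module.End.mul_apply, Module.End.mul_apply, bigX_single, diag_single, diag_single,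
      bigX_single]
    congr 1
    rw [← sub_eq_zero, ← Module.forall_dual_apply_eq_zero_iff ℂ]
    intro f
    have h1 := hzero (0, Pi.single l (f.smulRight w), 0, 0)
    rw [momentDeriv, bigY_single_smulRight,
      bigX_eq_zero (q := (0, Pi.single l (f.smulRight w), 0, 0)) rfl,
      bigI_eq_zero (q := (0, Pi.single l (f.smulRight w), 0, 0)) rfl,
      bigJ_eq_zero (q := (0, Pi.single l (f.smulRight w), 0, 0)) rfl] at h1
    simp only [mul_zero, zero_mul, add_zero, zero_add, LinearMap.smulRight_zero,
      LinearMap.zero_smulRight, sub_zero] at h1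
    rw [hcomm', trace_comp_smulRight] at h1
    simpa [bigX_single, diag_single] using h1
  have hI : diag ξ (bigI z) = 0 := by
    rw [bigI_def, diag_single]
    refine (congrArg _ ?_).trans (Pi.single_zero n)
    rw [← Module.forall_dual_apply_eq_zero_iff ℂ]
    intro f
    have h1 := hzero (0, 0, 0, f)
    rw [momentDeriv, bigY_eq_zero (q := (0, 0, 0, f)) rfl,
      bigX_eq_zero (q := (0, 0, 0, f)) rfl, bigI_eq_zero (q := (0, 0, 0, f)) rfl] at h1
    simp only [mul_zero, zero_mul, add_zero, LinearMap.smulRight_zero, sub_zero, zero_sub] at h1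
    replace h1 := neg_eq_zero.1 ((map_neg (LinearMap.trace ℂ (∀ i, V i)) _).symm.trans
      ((congrArg _ (mul_neg (diag ξ) _).symm).trans h1))
    rw [trace_comp_smulRight, bigJ_apply, diag_apply, bigI_def, Pi.single_eq_same] at h1
    exact h1
  have := diag_eq_zero_of_commute hz hX hY hI
  ext g
  simp [hφξ, this]

end CyclicQuad


/-! ### Slices and the dimension of the quotient -/

namespace CyclicQuad

variable {m : ℕ} [NeZero m] {V : ZMod m → Type*} [∀ i, AddCommGroup (V i)] [∀ i, Module ℂ (V i)]
  [∀ i, FiniteDimensional ℂ (V i)] {n : ZMod m}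

theorem isPolyMap_ev (p : FreeAlgebra ℂ (Bool ⊕ ZMod m)) {c : CyclicQuad V n → ∀ i, V i}
    (hc : IsPolyMap c) : IsPolyMap (fun q => ev q p (c q)) := by
  induction p using FreeAlgebra.induction generalizing c with
  | grade0 r =>
    simp only [Algebra.algebraMap_eq_smul_one, map_smul, map_one, LinearMap.smul_apply,
      Module.End.one_apply]
    exact hc.linear_comp (r • LinearMap.id)
  | grade1 s =>
    rcases s with (_ | _) | k
    · simp only [ev_Y]
      exact (isPolyMap_linear (E := CyclicQuad V n) bigY).apply hc
    · simp only [ev_X]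
      exact (isPolyMap_linear (E := CyclicQuad V n) bigX).apply hc
    · simp only [ev_proj]
      exact hc.linear_comp (LinearMap.single ℂ V k ∘ₗ LinearMap.proj k)
  | mul p p' hp hp' =>
    simp only [map_mul, Module.End.mul_apply]
    exact hp (hp' hc)
  | add p p' hp hp' =>
    simp only [map_add, LinearMap.add_apply]
    exact (hp hc).add (hp' hc)

theorem isPolyMap_evI (p : FreeAlgebra ℂ (Bool ⊕ ZMod m)) :
    IsPolyMap (fun q : CyclicQuad V n => evI q p) :=
  isPolyMap_ev p (isPolyMap_linear (E := CyclicQuad V n) bigI)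

theorem isPolyMap_moment : IsPolyMap (moment : CyclicQuad V n → ∀ l, V l →ₗ[ℂ] V l) := by
  have hX : IsPolyMap (fun q : CyclicQuad V n => bigX q) := isPolyMap_linear (E := CyclicQuad V n) bigX
  have hY : IsPolyMap (fun q : CyclicQuad V n => bigY q) := isPolyMap_linear (E := CyclicQuad V n) bigY
  have hR : IsPolyMap (fun q : CyclicQuad V n =>
      ((bigJ q).smulRight (bigI q) : Module.End ℂ (∀ i, V i))) :=
    (isPolyMap_linear (E := CyclicQuad V n) bigJ).bilinear (isPolyMap_linear (E := CyclicQuad V n) bigI) LinearMap.smulRightₗ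
  have h : IsPolyMap (defect : CyclicQuad V n → _) :=
    (((hX.linearMap_comp hY).sub (hY.linearMap_comp hX)).add (isPolyMap_const _)).sub hR
  refine IsPolyMap.pi fun l => ?_
  exact h.linear_comp (LinearMap.llcomp ℂ _ _ _ (LinearMap.proj l) ∘ₗ
    LinearMap.lcomp ℂ _ (LinearMap.single ℂ V l))

/-- The functions `j p(X, Y) i` are polynomial, invariant and separate orbits, so the GIT quotient
is the set of orbits. -/
theorem mk_eq_mk_iff {x y : cyclicSet V n} :
    (GITQuotient.mk cyclicAct (cyclicSet V n) x = GITQuotient.mk cyclicAct (cyclicSet V n) y) ↔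
      ∃ a : ∀ i, V i ≃ₗ[ℂ] V i, (y : CyclicQuad V n) = cyclicAct a x := by
  refine Quotient.eq.trans ⟨fun h => ?_, ?_⟩
  · refine exists_eq_cyclicAct x.2 y.2 fun p => ?_
    have hp : IsPolyMap (fun q : CyclicQuad V n => bigJ q (evI q p)) :=
      (isPolyMap_linear (E := CyclicQuad V n) bigJ).apply (isPolyMap_evI p)
    refine h _ (isRegularOn_of_mem_polyFun _ hp.mem_polyFun) ?_
    intro a u v huv
    simp only [huv, evI_cyclicAct, bigJ_cyclicAct]
  · rintro ⟨a, ha⟩ f _ hf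
    exact (hf a x y ha).symm

/-- Columns of the vectors `p(X, Y) i`, for chosen `p`, in the vector spaces `V_i`. -/
def frame (S : ∀ i : ZMod m, Fin (Module.finrank ℂ (V i)) → FreeAlgebra ℂ (Bool ⊕ ZMod m))
    (q : CyclicQuad V n) (i : ZMod m) : V i →ₗ[ℂ] V i :=
  (Module.finBasis ℂ (V i)).constr ℂ fun a => evI q (S i a) i

variable (S : ∀ i : ZMod m, Fin (Module.finrank ℂ (V i)) → FreeAlgebra ℂ (Bool ⊕ ZMod m))

theorem frame_basis (q : CyclicQuad V n) (i : ZMod m) (a : Fin (Module.finrank ℂ (V i))) :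
    frame S q i (Module.finBasis ℂ (V i) a) = evI q (S i a) i :=
  Module.Basis.constr_basis _ ℂ _ a

theorem frame_cyclicAct (a : ∀ i, V i ≃ₗ[ℂ] V i) (q : CyclicQuad V n) (i : ZMod m) :
    frame S (cyclicAct a q) i = (a i).toLinearMap ∘ₗ frame S q i := by
  refine (Module.finBasis ℂ (V i)).ext fun k => ?_
  rw [frame_basis, evI_cyclicAct, LinearMap.comp_apply, frame_basis]
  rfl

theorem isPolyMap_frame (i : ZMod m) : IsPolyMap (fun q : CyclicQuad V n => frame S q i) := by
  refine IsPolyMap.linearMap_of_basis (Module.finBasis ℂ (V i)) fun k => ?_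
  simp only [frame_basis]
  exact (isPolyMap_evI (S i k)).proj i

/-- The equations of the slice where the chosen vectors form the standard frame. -/
def sliceMap (q : CyclicQuad V n) : (∀ l, V l →ₗ[ℂ] V l) × (∀ l, V l →ₗ[ℂ] V l) :=
  (moment q, fun l => frame S q l - LinearMap.id)

theorem sliceMap_eq_zero_iff {q : CyclicQuad V n} :
    sliceMap S q = 0 ↔ q ∈ cyclicSet V n ∧ ∀ l, frame S q l = LinearMap.id := by
  rw [mem_cyclicSet_iff_moment, sliceMap, Prod.mk_eq_zero, funext_iff, funext_iff]
  simp [sub_eq_zero]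

theorem isPolyMap_sliceMap : IsPolyMap (sliceMap S : CyclicQuad V n → _) :=
  isPolyMap_moment.prodMk (IsPolyMap.pi fun l => (isPolyMap_frame S l).sub (isPolyMap_const _))

/-- The slice equations are submersive along the slice. -/
theorem exists_weakDeriv_sliceMap {z : CyclicQuad V n} (hz : sliceMap S z = 0)
    (h : (∀ l, V l →ₗ[ℂ] V l) × (∀ l, V l →ₗ[ℂ] V l)) :
    ∃ v, HasWeakDeriv (fun t => sliceMap S (z + t • v)) h := by
  obtain ⟨hzc, hzf⟩ := (sliceMap_eq_zero_iff S).1 hz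
  obtain ⟨D, hD⟩ := (isPolyMap_sliceMap S).exists_weakDeriv z
  have hD1 : ∀ v l, (D v).1 l = LinearMap.proj l ∘ₗ momentDeriv z v ∘ₗ LinearMap.single ℂ V l :=
    fun v l => ((hD v).linear_comp (LinearMap.proj l ∘ₗ LinearMap.fst ℂ _ _)).unique
      (hasWeakDeriv_moment z v l)
  -- Along orbits the moment map is stationary while the frame moves by `ξ` itself, its value on the
  -- slice being the identity. The derivative of `sliceMap` is thus triangular: solve for the moment
  -- component, then correct the frame component along the orbit.
  have hinf : ∀ ξ, D (infAct ξ z) = (0, ξ) := by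
    intro ξ
    refine Prod.ext (funext fun l => ?_) (funext fun l => ?_)
    · rw [hD1, momentDeriv_infAct ξ hzc]
      ext
      simp
    · refine (Module.finBasis ℂ (V l)).ext fun a => ?_
      have h1 := (hD (infAct ξ z)).linear_comp
        (LinearMap.applyₗ (Module.finBasis ℂ (V l) a) ∘ₗ LinearMap.proj l ∘ₗ LinearMap.snd ℂ _ _)
      have h2 := ((hasWeakDeriv_evI_infAct ξ z (S l a)).linear_comp (LinearMap.proj l)).add
        (hasWeakDeriv_const (-Module.finBasis ℂ (V l) a))
      have h3 := h1.unique (w' := diag ξ (evI z (S l a)) l + 0) (by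
        convert! h2 using 2 with t
        simp only [LinearMap.comp_apply, LinearMap.snd_apply, LinearMap.proj_apply,
          LinearMap.applyₗ_apply_apply, sliceMap, LinearMap.sub_apply, frame_basis,
          LinearMap.id_apply]
        exact sub_eq_add_neg _ _)
      rw [diag_apply, ← frame_basis, hzf, add_zero] at h3
      exact h3
  obtain ⟨v, hv⟩ := exists_momentDeriv_eq hzc h.1
  refine ⟨v + infAct (h.2 - (D v).2) z, ?_⟩
  have hDv : D (v + infAct (h.2 - (D v).2) z) = h := by
    rw [map_add, hinf]
    refine Prod.ext (funext fun l => ?_) ?_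
    · simp [hD1, hv]
    · simp
  have := hD (v + infAct (h.2 - (D v).2) z)
  rwa [hDv] at this

/-- Each basis vector of each `V i` is of the form `p i`; such `p` make the frame at `z` equal to
the identity, so `z` itself lies on a slice. -/
theorem exists_slice {z : CyclicQuad V n} (hz : z ∈ cyclicSet V n) :
    ∃ S, sliceMap S z = 0 := by
  choose S hS using fun i (a : Fin (Module.finrank ℂ (V i))) =>
    evI_surjective hz (Pi.single i (Module.finBasis ℂ (V i) a))
  refine ⟨S, (sliceMap_eq_zero_iff S).2 ⟨hz, fun i => ?_⟩⟩
  refine (Module.finBasis ℂ (V i)).ext fun a => ?_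
  rw [frame_basis, hS, Pi.single_eq_same, LinearMap.id_apply]

/-- The determinant of the frame. -/
def frameDet (q : CyclicQuad V n) : ℂ := ∏ i, LinearMap.det (frame S q i)

theorem frameDet_mem_polyFun : frameDet S ∈ polyFun (CyclicQuad V n) :=
  prod_mem_polyFun _ fun i _ => (isPolyMap_frame S i).exists_adjugate.1

/-- Multiplying the adjugate at one vertex by the determinants at the others gives a common
denominator for all vertices. -/
theorem exists_frame_adjugate (i : ZMod m) :
    ∃ A : CyclicQuad V n → V i →ₗ[ℂ] V i, IsPolyMap A ∧
      ∀ q, A q ∘ₗ frame S q i = frameDet S q • LinearMap.id := by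
  obtain ⟨A, hA, hA'⟩ := (isPolyMap_frame (n := n) S i).exists_adjugate.2
  refine ⟨fun q => (∏ k ∈ Finset.univ.erase i, LinearMap.det (frame S q k)) • A q,
    hA.smul (prod_mem_polyFun _ fun k _ => (isPolyMap_frame S k).exists_adjugate.1), fun q => ?_⟩
  rw [LinearMap.smul_comp, hA', smul_smul, frameDet, ← Finset.prod_erase_mul _ _ (Finset.mem_univ i)]

/-- A polynomial function of the normal form of `q` is, up to a power of the frame determinant,
a polynomial function of `q`. -/
theorem exists_clear_denominators {p : CyclicQuad V n → ℂ} (hp : p ∈ polyFun (CyclicQuad V n)) :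
    ∃ k : ℕ, ∃ P ∈ polyFun (CyclicQuad V n), ∀ (y : CyclicQuad V n) (a : ∀ i, V i ≃ₗ[ℂ] V i),
      (∀ l, frame S y l = LinearMap.id) →
      P (cyclicAct a y) = frameDet S (cyclicAct a y) ^ k * p y := by
  induction hp using Algebra.adjoin_induction with
  | mem x hx =>
    obtain ⟨φ, rfl⟩ := hx
    choose A hA hA' using exists_frame_adjugate (n := n) S
    -- The normal form of `q`, obtained by acting with the inverse frame and multiplied by
    -- `frameDet`: replacing inverses by adjugates makes it polynomial. The `j` component involves
    -- no inverse, so there the factor is put in by hand.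
    let N : CyclicQuad V n → CyclicQuad V n := fun q =>
      (fun l => A l q ∘ₗ q.1 l ∘ₗ frame S q (l + 1), fun l => A (l + 1) q ∘ₗ q.2.1 l ∘ₗ frame S q l,
        A n q ∘ₗ q.2.2.1, frameDet S q • (q.2.2.2 ∘ₗ frame S q n))
    have hN : IsPolyMap N := by
      refine (IsPolyMap.pi fun l => ?_).prodMk ((IsPolyMap.pi fun l => ?_).prodMk
        (IsPolyMap.prodMk ?_ ?_))
      · exact (hA l).linearMap_comp
          ((isPolyMap_id.fst.proj l).linearMap_comp (isPolyMap_frame S (l + 1)))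
      · exact (hA (l + 1)).linearMap_comp
          ((isPolyMap_id.snd.fst.proj l).linearMap_comp (isPolyMap_frame S l))
      · exact (hA n).linearMap_comp isPolyMap_id.snd.snd.fst
      · exact IsPolyMap.smul (frameDet_mem_polyFun S)
          (isPolyMap_id.snd.snd.snd.linearMap_comp (isPolyMap_frame S n))
    refine ⟨1, fun q => φ (N q), hN φ, fun y a hy => ?_⟩
    have hf : ∀ l, frame S (cyclicAct a y) l = (a l).toLinearMap := fun l => by
      rw [frame_cyclicAct, hy, LinearMap.comp_id]
    have hAa : ∀ l v, A l (cyclicAct a y) (a l v) = frameDet S (cyclicAct a y) • v := by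
      intro l v
      have := LinearMap.congr_fun (hA' l (cyclicAct a y)) v
      rwa [hf] at this
    have hNy : N (cyclicAct a y) = frameDet S (cyclicAct a y) • y := by
      obtain ⟨h1, h2, h3, h4⟩ := eq_cyclicAct_iff.1 (rfl : cyclicAct a y = cyclicAct a y)
      refine Prod.ext ?_ (Prod.ext ?_ (Prod.ext ?_ ?_))
      · ext l v
        change A l (cyclicAct a y) ((cyclicAct a y).1 l (frame S (cyclicAct a y) (l + 1) v)) = _
        rw [hf, LinearEquiv.coe_coe, h1, hAa]
        rfl
      · ext l v
        change A (l + 1) (cyclicAct a y) ((cyclicAct a y).2.1 l (frame S (cyclicAct a y) l v)) = _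
        rw [hf, LinearEquiv.coe_coe, h2, hAa]
        rfl
      · ext
        change A n (cyclicAct a y) ((cyclicAct a y).2.2.1 1) = _
        rw [h3, hAa]
        rfl
      · ext v
        change frameDet S (cyclicAct a y) •
          (cyclicAct a y).2.2.2 (frame S (cyclicAct a y) n v) = _
        rw [hf, LinearEquiv.coe_coe, h4]
        rfl
    simp [hNy]
  | algebraMap r => exact ⟨0, _, const_mem_polyFun r, fun _ _ _ => by simp⟩
  | add x y _ _ hx hy =>
    obtain ⟨k, P, hP, h1⟩ := hx
    obtain ⟨l, Q, hQ, h2⟩ := hy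
    refine ⟨k + l, frameDet S ^ l * P + frameDet S ^ k * Q,
      (polyFun _).add_mem ((polyFun _).mul_mem ((polyFun _).pow_mem (frameDet_mem_polyFun S) _) hP)
        ((polyFun _).mul_mem ((polyFun _).pow_mem (frameDet_mem_polyFun S) _) hQ),
      fun y a hy => ?_⟩
    simp only [Pi.add_apply, Pi.mul_apply, Pi.pow_apply, h1 y a hy, h2 y a hy]
    ring
  | mul x y _ _ hx hy =>
    obtain ⟨k, P, hP, h1⟩ := hx
    obtain ⟨l, Q, hQ, h2⟩ := hy
    refine ⟨k + l, P * Q, (polyFun _).mul_mem hP hQ, fun y a hy => ?_⟩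
    simp only [Pi.mul_apply, h1 y a hy, h2 y a hy]
    ring

/-- The map from the slice to the quotient. -/
def sliceToQuotient (q : {q : CyclicQuad V n | sliceMap S q = 0}) : CyclicQuiverVariety V n :=
  GITQuotient.mk cyclicAct (cyclicSet V n) ⟨q, ((sliceMap_eq_zero_iff S).1 q.2).1⟩

/-- The frame is equivariant, so where it is invertible its inverse moves a point to the slice, and
two slice points in one orbit differ by the identity. For openness, clearing denominators describes
the saturation of `p ≠ 0` by the polynomial condition `frameDet * P ≠ 0`. -/
theorem isOpenEmbedding_sliceToQuotient :
    @IsOpenEmbedding _ _ (zariski {q : CyclicQuad V n | sliceMap S q = 0}) _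
      (sliceToQuotient S) := by
  let := zariski {q : CyclicQuad V n | sliceMap S q = 0}
  have hT : ∀ q : {q : CyclicQuad V n | sliceMap S q = 0}, ∀ l, frame S q.1 l = LinearMap.id :=
    fun q => ((sliceMap_eq_zero_iff S).1 q.2).2
  refine .of_continuous_injective_isOpenMap ?_ ?_ ?_
  · let := zariski (cyclicSet V n)
    refine Continuous.comp (g := GITQuotient.mk cyclicAct (cyclicSet V n))
      continuous_coinduced_rng ?_
    exact continuous_zariski_of_linear LinearMap.id _ fun _ => rfl
  · intro x y hxy
    obtain ⟨a, ha⟩ := mk_eq_mk_iff.1 hxy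
    have ha1 : ∀ l, a l = LinearEquiv.refl ℂ (V l) := by
      intro l
      have h := frame_cyclicAct S a x.1 l
      rw [← ha, hT, hT, LinearMap.comp_id] at h
      exact LinearEquiv.toLinearMap_injective h.symm
    refine Subtype.ext (ha.trans ?_).symm
    symm
    refine eq_cyclicAct_iff.2 ?_
    simp [ha1]
  · rw [(isTopologicalBasis_zariski _).isOpenMap_iff]
    rintro _ ⟨p, hp, rfl⟩
    obtain ⟨k, P, hP, hPp⟩ := exists_clear_denominators S hp
    rw [isOpen_coinduced]
    have hopen := isOpen_zariski_basic (cyclicSet V n)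
      ((polyFun _).mul_mem (frameDet_mem_polyFun S) hP)
    convert hopen using 1
    have hdet : ∀ (y : CyclicQuad V n) (a : ∀ i, V i ≃ₗ[ℂ] V i),
        (∀ l, frame S y l = LinearMap.id) → frameDet S (cyclicAct a y) ≠ 0 := by
      intro y a hy
      refine Finset.prod_ne_zero_iff.2 fun l _ => ?_
      rw [frame_cyclicAct, hy, LinearMap.comp_id]
      exact (LinearEquiv.isUnit_det' (a l)).ne_zero
    ext x
    constructor
    · rintro ⟨y, hy, hyx⟩
      obtain ⟨a, ha⟩ := mk_eq_mk_iff.1 hyx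
      change (frameDet S * P : CyclicQuad V n → ℂ) x ≠ 0
      rw [ha, Pi.mul_apply, hPp _ a (hT y)]
      exact mul_ne_zero (hdet _ a (hT y)) (mul_ne_zero (pow_ne_zero _ (hdet _ a (hT y))) hy)
    · intro hx
      have hx1 : frameDet S x.1 ≠ 0 := left_ne_zero_of_mul hx
      have hx2 : P x.1 ≠ 0 := right_ne_zero_of_mul hx
      let e : ∀ l, V l ≃ₗ[ℂ] V l := fun l => LinearEquiv.ofIsUnitDet (f := frame S x.1 l)
        (v := Module.finBasis ℂ (V l)) (v' := Module.finBasis ℂ (V l)) (by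
          rw [LinearMap.det_toMatrix]
          exact (Finset.prod_ne_zero_iff.1 hx1 l (Finset.mem_univ l)).isUnit)
      have he : ∀ l, (e l).toLinearMap = frame S x.1 l := fun l => by
        ext v
        simp [e]
      let y : CyclicQuad V n := cyclicAct (fun l => (e l).symm) x.1
      have hy : sliceMap S y = 0 := by
        refine (sliceMap_eq_zero_iff S).2 ⟨cyclicAct_mem _ x.2, fun l => ?_⟩
        rw [frame_cyclicAct, ← he]
        ext v
        simp
      have hxy : x.1 = cyclicAct e y := by
        rw [eq_cyclicAct_iff]
        simp [y, cyclicAct]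
      refine ⟨⟨y, hy⟩, ?_, mk_eq_mk_iff.2 ⟨e, hxy⟩⟩
      rw [hxy, hPp y e (hT ⟨y, hy⟩)] at hx2
      exact right_ne_zero_of_mul hx2

variable (V n) in
/-- The dimension of the cyclic quiver variety. -/
theorem exists_topologicalKrullDim_eq [Nonempty (CyclicQuiverVariety V n)] :
    ∃ d : ℕ, topologicalKrullDim (CyclicQuiverVariety V n) = d ∧
      d + 2 * ∑ i, Module.finrank ℂ (V i) ^ 2 = 2 * (Module.finrank ℂ (V n) +
        ∑ i, Module.finrank ℂ (V i) * Module.finrank ℂ (V (i + 1))) := by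
  have hE : Module.finrank ℂ (CyclicQuad V n) = 2 * (Module.finrank ℂ (V n) +
        ∑ i, Module.finrank ℂ (V i) * Module.finrank ℂ (V (i + 1))) := by
    simp only [Module.finrank_prod, Module.finrank_pi_fintype, Module.finrank_linearMap,
      Module.finrank_self, mul_one, one_mul]
    rw [Finset.sum_congr rfl fun i _ => mul_comm (Module.finrank ℂ (V (i + 1))) _]
    ring
  have hH : Module.finrank ℂ ((∀ l, V l →ₗ[ℂ] V l) × (∀ l, V l →ₗ[ℂ] V l))
      = 2 * ∑ i, Module.finrank ℂ (V i) ^ 2 := by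
    simp only [Module.finrank_prod, Module.finrank_pi_fintype, Module.finrank_linearMap, pow_two]
    ring
  have hdim : ∀ x : CyclicQuiverVariety V n, ∃ S, ∃ z : CyclicQuad V n, sliceMap S z = 0 ∧
      x ∈ range (sliceToQuotient (V := V) (n := n) S) ∧
      ∃ d : ℕ, @topologicalKrullDim _ (zariski {q : CyclicQuad V n | sliceMap S q = 0}) = d ∧
        d + Module.finrank ℂ ((∀ l, V l →ₗ[ℂ] V l) × (∀ l, V l →ₗ[ℂ] V l))
          = Module.finrank ℂ (CyclicQuad V n) := by
    intro x
    obtain ⟨z, rfl⟩ := Quotient.exists_rep x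
    obtain ⟨S, hS⟩ := exists_slice z.2
    exact ⟨S, z, hS, ⟨⟨z, hS⟩, rfl⟩, exists_topologicalKrullDim_zeroSet (isPolyMap_sliceMap S)
      (fun q hq h => exists_weakDeriv_sliceMap S hq h) ⟨z, hS⟩⟩
  obtain ⟨S, z, hz, -, d, -, hd⟩ := hdim (Classical.arbitrary _)
  refine ⟨d, topologicalKrullDim_eq_of_cover d fun x => ?_, by rw [← hH, ← hE, hd]⟩
  obtain ⟨S', z', hz', hx, d', hd1, hd2⟩ := hdim x
  refine ⟨_, zariski _, sliceToQuotient S', isOpenEmbedding_sliceToQuotient S', hx, ?_⟩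
  -- All charts have the same dimension because `d` and `d'` satisfy the same equation.
  rw [hd1, show d' = d by omega]

end CyclicQuad


/-- Mutually inverse linear maps between `Z` and `Z'` that preserve the orbits induce an
isomorphism of the quotients. -/
theorem exists_isVarietyIso {E E' : Type*} [AddCommGroup E] [Module ℂ E] [AddCommGroup E']
    [Module ℂ E'] {G G' : Type*} {act : G → E → E} {act' : G' → E' → E'} {Z : Set E} {Z' : Set E'}
    {f : E → E'} {f' : E' → E} (hf : IsLinearMap ℂ f) (hf' : IsLinearMap ℂ f')
    (hZ : ∀ x ∈ Z, f x ∈ Z') (hZ' : ∀ y ∈ Z', f' y ∈ Z)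
    (hleft : ∀ x ∈ Z, f' (f x) = x) (hright : ∀ y ∈ Z', f (f' y) = y)
    (hact : ∀ g x, ∃ g', f (act g x) = act' g' (f x))
    (hact' : ∀ g' y, ∃ g, f' (act' g' y) = act g (f' y)) :
    ∃ (ψ : GITQuotient act Z → GITQuotient act' Z') (χ : GITQuotient act' Z' → GITQuotient act Z),
      IsVarietyIso ψ ∧ Function.LeftInverse χ ψ ∧ Function.RightInverse χ ψ ∧
      (∀ x : Z, ∃ h : f x.1 ∈ Z',
        ψ (GITQuotient.mk _ _ x) = GITQuotient.mk _ _ ⟨f x.1, h⟩) ∧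
      (∀ y : Z', ∃ h : f' y.1 ∈ Z,
        χ (GITQuotient.mk _ _ y) = GITQuotient.mk _ _ ⟨f' y.1, h⟩) := by
  let F : Z → Z' := fun x => ⟨f x, hZ x x.2⟩
  let F' : Z' → Z := fun y => ⟨f' y, hZ' y y.2⟩
  have hF : ∀ x, (F x : E') = hf.mk' f x := fun _ => rfl
  have hF' : ∀ x, (F' x : E) = hf'.mk' f' x := fun _ => rfl
  have hFF : ∀ x, F' (F x) = x := fun x => Subtype.ext (hleft x x.2)
  have hFF' : ∀ y, F (F' y) = y := fun y => Subtype.ext (hright y y.2)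
  -- Invariant regular functions pull back to invariant regular functions, so inseparable points
  -- have inseparable images.
  have hrel : ∀ x y, gitSetoid act Z x y → gitSetoid act' Z' (F x) (F y) := by
    intro x y h p hp hinv
    refine h (p ∘ F) (hp.comp_linear _ F hF) fun g u v huv => ?_
    obtain ⟨g', hg'⟩ := hact g u
    exact hinv g' (F u) (F v) (by rw [← hg', ← huv])
  have hrel' : ∀ x y, gitSetoid act' Z' x y → gitSetoid act Z (F' x) (F' y) := by
    intro x y h p hp hinv
    refine h (p ∘ F') (hp.comp_linear _ F' hF') fun g u v huv => ?_
    obtain ⟨g', hg'⟩ := hact' g u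
    exact hinv g' (F' u) (F' v) (by rw [← hg', ← huv])
  let ψ : GITQuotient act Z → GITQuotient act' Z' := Quotient.map F hrel
  let χ : GITQuotient act' Z' → GITQuotient act Z := Quotient.map F' hrel'
  have hχψ : Function.LeftInverse χ ψ := by
    rintro ⟨x⟩
    exact congrArg (GITQuotient.mk act Z) (hFF x)
  have hψχ : Function.RightInverse χ ψ := by
    rintro ⟨y⟩
    exact congrArg (GITQuotient.mk act' Z') (hFF' y)
  have hψ : Continuous ψ := by
    refine continuous_coinduced_dom.2 ?_
    let := zariski Z
    let := zariski Z'
    exact Continuous.comp (g := GITQuotient.mk act' Z') continuous_coinduced_rng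
      (continuous_zariski_of_linear _ F hF)
  have hχ : Continuous χ := by
    refine continuous_coinduced_dom.2 ?_
    let := zariski Z
    let := zariski Z'
    exact Continuous.comp (g := GITQuotient.mk act Z) continuous_coinduced_rng
      (continuous_zariski_of_linear _ F' hF')
  refine ⟨ψ, χ, ⟨?_, ?_⟩, hχψ, hψχ, fun x => ⟨hZ x x.2, rfl⟩, fun y => ⟨hZ' y y.2, rfl⟩⟩
  · exact (Homeomorph.mk ⟨ψ, χ, hχψ, hψχ⟩ hψ hχ).isHomeomorph
  · intro O p _
    refine ⟨fun h => h.comp_linear _ F hF, fun h => ?_⟩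
    have h1 := IsRegularOn.comp_linear _ F' hF' h
    have h2 : ∀ y, ψ (GITQuotient.mk act Z (F' y)) = GITQuotient.mk act' Z' y :=
      fun y => congrArg (GITQuotient.mk act' Z') (hFF' y)
    have h3 : F' ⁻¹' (GITQuotient.mk act Z ⁻¹' (ψ ⁻¹' O)) = GITQuotient.mk act' Z' ⁻¹' O := by
      ext y
      rw [mem_preimage, mem_preimage, mem_preimage, mem_preimage, h2]
    have h4 : ((p ∘ ψ) ∘ GITQuotient.mk act Z) ∘ F' = p ∘ GITQuotient.mk act' Z' :=
      funext fun y => congrArg p (h2 y)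
    rw [h3, h4] at h1
    exact h1

/-! ### Weights of the cyclic group -/

section Characters

variable {m : ℕ} {Γ : Type*} [Group Γ] (hΓ : Nat.card Γ = m) {ε : Γ →* ℂˣ}

include hΓ in
-- The representative `val` drops from `m - 1` to `0` on wrapping around, which is harmless since `ε
-- g ^ m = 1`.
theorem character_pow_succ [NeZero m] (g : Γ) (i : ZMod m) :
    (ε g : ℂ) ^ (i + 1).val = (ε g : ℂ) * (ε g : ℂ) ^ i.val := by
  have h1 : (ε g : ℂ) ^ m = 1 := by
    rw [← Units.val_pow_eq_pow_val, ← map_pow, ← hΓ, pow_card_eq_one', map_one, Units.val_one]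
  rw [← pow_succ', ZMod.val_add, ZMod.val_one_eq_one_mod, Nat.add_mod_mod,
    ← pow_eq_pow_mod _ h1]

include hΓ in
-- A faithful `ε` embeds the finite group in `ℂˣ`, so the group is cyclic; a generator has order
-- `m`, and its powers below `m` are distinct.
theorem eq_of_forall_character_pow_eq [NeZero m] (hε : Function.Injective ε) {i j : ZMod m}
    (h : ∀ g, (ε g : ℂ) ^ i.val = (ε g : ℂ) ^ j.val) : i = j := by
  have : Finite Γ := Nat.finite_of_card_ne_zero (by rw [hΓ]; exact NeZero.ne m)
  have hcyc : IsCyclic Γ := isCyclic_of_injective_ringHom ((Units.coeHom ℂ).comp ε)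
    (Units.val_injective.comp hε)
  obtain ⟨g, hg⟩ := hcyc.exists_generator
  have hord : orderOf g = m := by
    rw [orderOf_eq_card_of_forall_mem_zpowers hg, hΓ]
  have h1 : g ^ i.val = g ^ j.val := hε (Units.ext (by simpa using h g))
  refine ZMod.val_injective m (pow_injOn_Iio_orderOf (x := g) ?_ ?_ h1)
  · rw [hord]
    exact ZMod.val_lt i
  · rw [hord]
    exact ZMod.val_lt j

variable {U : Type*} [AddCommGroup U] [Module ℂ U] {ρ : Representation ℂ Γ U}
  {V : ZMod m → Type*} [∀ i, AddCommGroup (V i)] [∀ i, Module ℂ (V i)] {Φ : U ≃ₗ[ℂ] ∀ i, V i}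
  (hΦ : ∀ (g : Γ) (u : U) (i : ZMod m), Φ (ρ g u) i = ((ε g : ℂ) ^ i.val) • Φ u i)

include hΦ in
theorem rho_symm_single (g : Γ) (i : ZMod m) (v : V i) :
    ρ g (Φ.symm (Pi.single i v)) = ((ε g : ℂ) ^ i.val) • Φ.symm (Pi.single i v) := by
  apply Φ.injective
  ext k
  rw [hΦ, map_smul, Φ.apply_symm_apply, Pi.smul_apply]
  by_cases h : k = i
  · subst h
    rfl
  · simp [h]

include hΓ hΦ in
theorem eq_single_of_forall_rho [NeZero m] (hε : Function.Injective ε) {w : U} {i : ZMod m}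
    (hw : ∀ g, ρ g w = ((ε g : ℂ) ^ i.val) • w) : Φ w = Pi.single i (Φ w i) := by
  ext k
  by_cases h : k = i
  · subst h
    simp
  · rw [Pi.single_eq_of_ne h]
    by_contra hne
    refine h (eq_of_forall_character_pow_eq hΓ hε fun g => ?_)
    have h1 := hΦ g w k
    rw [hw, map_smul, Pi.smul_apply] at h1
    exact (smul_left_injective ℂ hne h1).symm

end Characters

/-! ### Equivariant quadruples as block-cyclic matrices -/

section Blocks

open CyclicQuad

variable {m : ℕ} {U : Type*} [AddCommGroup U] [Module ℂ U]
  {V : ZMod m → Type*} [∀ i, AddCommGroup (V i)] [∀ i, Module ℂ (V i)] (Φ : U ≃ₗ[ℂ] ∀ i, V i)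
  (n : ZMod m)

theorem isLinearMap_blocks : IsLinearMap ℂ (blocks Φ n) where
  map_add q r := by
    refine Prod.ext ?_ (Prod.ext ?_ (Prod.ext ?_ ?_)) <;>
      (try refine funext fun l => ?_) <;> refine LinearMap.ext fun x => ?_ <;> simp [blocks]
  map_smul c q := by
    refine Prod.ext ?_ (Prod.ext ?_ (Prod.ext ?_ ?_)) <;>
      (try refine funext fun l => ?_) <;> refine LinearMap.ext fun x => ?_ <;> simp [blocks]

variable [NeZero m]

theorem blockCyclic_fst (q : CyclicQuad V n) (u : U) :
    (blockCyclic Φ n q).1 u = Φ.symm (bigX q (Φ u)) := rfl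

theorem blockCyclic_snd_fst (q : CyclicQuad V n) (u : U) :
    (blockCyclic Φ n q).2.1 u = Φ.symm (bigY q (Φ u)) := rfl

theorem blockCyclic_snd_snd_fst (q : CyclicQuad V n) (c : ℂ) :
    (blockCyclic Φ n q).2.2.1 c = Φ.symm (c • bigI q) := by
  rw [bigI_def, ← Pi.single_smul, ← map_smul, smul_eq_mul, mul_one]
  rfl

theorem blockCyclic_snd_snd_snd (q : CyclicQuad V n) (u : U) :
    (blockCyclic Φ n q).2.2.2 u = bigJ q (Φ u) := rfl

theorem isLinearMap_blockCyclic : IsLinearMap ℂ (blockCyclic Φ n : CyclicQuad V n → Quad U ℂ) where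
  map_add q r := by
    refine Prod.ext ?_ (Prod.ext ?_ (Prod.ext ?_ ?_)) <;> refine LinearMap.ext fun x => ?_
    · simp [blockCyclic_fst]
    · simp [blockCyclic_snd_fst]
    · simp only [Prod.snd_add, Prod.fst_add, LinearMap.add_apply, blockCyclic_snd_snd_fst, map_add,
        smul_add]
    · simp [blockCyclic_snd_snd_snd]
  map_smul c q := by
    refine Prod.ext ?_ (Prod.ext ?_ (Prod.ext ?_ ?_)) <;> refine LinearMap.ext fun x => ?_
    · simp [blockCyclic_fst]
    · simp [blockCyclic_snd_fst]
    · simp only [Prod.smul_snd, Prod.smul_fst, LinearMap.smul_apply, blockCyclic_snd_snd_fst,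
        map_smul, smul_comm c]
    · simp [blockCyclic_snd_snd_snd]

theorem blocks_blockCyclic (q : CyclicQuad V n) : blocks Φ n (blockCyclic Φ n q) = q := by
  refine Prod.ext ?_ (Prod.ext ?_ (Prod.ext ?_ ?_))
  · ext l v
    change Φ ((blockCyclic Φ n q).1 (Φ.symm (Pi.single (l + 1) v))) l = _
    rw [blockCyclic_fst, Φ.apply_symm_apply, Φ.apply_symm_apply, bigX_single, Pi.single_eq_same]
  · ext l v
    change Φ ((blockCyclic Φ n q).2.1 (Φ.symm (Pi.single l v))) (l + 1) = _
    rw [blockCyclic_snd_fst, Φ.apply_symm_apply, Φ.apply_symm_apply, bigY_single,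
      Pi.single_eq_same]
  · ext
    change Φ ((blockCyclic Φ n q).2.2.1 1) n = _
    rw [blockCyclic_snd_snd_fst, Φ.apply_symm_apply, one_smul, bigI_def, Pi.single_eq_same]
  · ext v
    change (blockCyclic Φ n q).2.2.2 (Φ.symm (Pi.single n v)) = _
    rw [blockCyclic_snd_snd_snd, Φ.apply_symm_apply, bigJ_apply, Pi.single_eq_same]

theorem linearMap_ext_symm_single {W : Type*} [AddCommGroup W] [Module ℂ W] {A B : U →ₗ[ℂ] W}
    (h : ∀ l v, A (Φ.symm (Pi.single l v)) = B (Φ.symm (Pi.single l v))) : A = B := by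
  have h1 : A ∘ₗ Φ.symm.toLinearMap = B ∘ₗ Φ.symm.toLinearMap := LinearMap.pi_ext h
  ext u
  simpa using LinearMap.congr_fun h1 (Φ u)

theorem blockCyclic_moment_iff (q : CyclicQuad V n) :
    (blockCyclic Φ n q).1 ∘ₗ (blockCyclic Φ n q).2.1
        - (blockCyclic Φ n q).2.1 ∘ₗ (blockCyclic Φ n q).1 + LinearMap.id
      = (blockCyclic Φ n q).2.2.1 ∘ₗ (blockCyclic Φ n q).2.2.2 ↔ q ∈ cyclicSet V n := by
  rw [mem_cyclicSet_iff, LinearMap.ext_iff, LinearMap.ext_iff, ← Φ.toEquiv.forall_congr_right]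
  refine forall_congr' fun u => ?_
  rw [← Φ.injective.eq_iff]
  simp [blockCyclic_fst, blockCyclic_snd_fst, blockCyclic_snd_snd_fst, blockCyclic_snd_snd_snd]

variable {Γ : Type*} [Group Γ] (hΓ : Nat.card Γ = m) {ε : Γ →* ℂˣ} {ρ : Representation ℂ Γ U}
  {Φ n}
  (hΦ : ∀ (g : Γ) (u : U) (i : ZMod m), Φ (ρ g u) i = ((ε g : ℂ) ^ i.val) • Φ u i)

theorem charRep_apply (χ : Γ →* ℂˣ) (g : Γ) (c : ℂ) : charRep χ g c = (χ g : ℂ) * c := rfl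

include hΓ hΦ in
-- Equivariance is a weight count. Stability is free: a stable subspace containing the image of `i`
-- contains that of `i j`, and the trace argument applies.
theorem blockCyclic_mem_nakajimaSet [FiniteDimensional ℂ U] {q : CyclicQuad V n}
    (hq : q ∈ cyclicSet V n) :
    blockCyclic Φ n q ∈ nakajimaSet ε ρ (charRep (ε ^ n.val)) 1 := by
  have hmom := (blockCyclic_moment_iff Φ n q).2 hq
  refine ⟨fun g => ?_, fun g => ?_, fun g => ?_, fun g => ?_, ?_, ?_⟩
  · refine LinearMap.ext fun u => Φ.injective ?_
    ext l
    change Φ ((blockCyclic Φ n q).1 (ρ g u)) l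
      = Φ ((ε g : ℂ) • ρ g ((blockCyclic Φ n q).1 u)) l
    rw [map_smul, Pi.smul_apply, hΦ, blockCyclic_fst, blockCyclic_fst, Φ.apply_symm_apply,
      Φ.apply_symm_apply, bigX_apply, bigX_apply, hΦ, map_smul, smul_smul,
      character_pow_succ hΓ]
  · refine LinearMap.ext fun u => Φ.injective ?_
    ext l
    obtain ⟨l, rfl⟩ : ∃ k, l = k + 1 := ⟨l - 1, by ring⟩
    change Φ ((blockCyclic Φ n q).2.1 (ρ g u)) (l + 1)
      = Φ (((ε g)⁻¹ : ℂ) • ρ g ((blockCyclic Φ n q).2.1 u)) (l + 1)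
    rw [map_smul, Pi.smul_apply, hΦ, blockCyclic_snd_fst, blockCyclic_snd_fst, Φ.apply_symm_apply,
      Φ.apply_symm_apply, bigY_apply, bigY_apply, hΦ, map_smul, smul_smul,
      character_pow_succ hΓ, inv_mul_cancel_left₀ (Units.ne_zero _)]
  · refine LinearMap.ext fun c => ?_
    change (blockCyclic Φ n q).2.2.1 (charRep (ε ^ n.val) g c)
      = ρ g ((blockCyclic Φ n q).2.2.1 c)
    rw [blockCyclic_snd_snd_fst, blockCyclic_snd_snd_fst, charRep_apply, mul_smul, map_smul,
      bigI_def, ← Pi.single_smul, rho_symm_single hΦ]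
    simp
  · refine LinearMap.ext fun u => ?_
    change (blockCyclic Φ n q).2.2.2 (ρ g u)
      = charRep (ε ^ n.val) g ((blockCyclic Φ n q).2.2.2 u)
    rw [blockCyclic_snd_snd_snd, blockCyclic_snd_snd_snd, charRep_apply, bigJ_apply, bigJ_apply,
      hΦ, map_smul]
    simp
  · rw [map_one]
    exact hmom
  · intro U' _ hX hY hI
    exact eq_top_of_commutator hmom U' hX hY fun u => hI _

include hΓ hΦ in
-- No block is lost: `X` takes weight `l + 1` to weight `l`, `Y` takes `l` to `l + 1`, `i` lands in
-- weight `n`, and `j` kills every other weight because distinct indices give distinct characters.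
theorem blockCyclic_blocks (hε : Function.Injective ε) {q : Quad U ℂ}
    (hq : q ∈ nakajimaSet ε ρ (charRep (ε ^ n.val)) 1) : blockCyclic Φ n (blocks Φ n q) = q := by
  obtain ⟨X, Y, i, j⟩ := q
  obtain ⟨hX, hY, hi, hj, -, -⟩ := hq
  refine Prod.ext ?_ (Prod.ext ?_ (Prod.ext ?_ ?_))
  · refine linearMap_ext_symm_single Φ fun l v => ?_
    obtain ⟨l, rfl⟩ : ∃ k, l = k + 1 := ⟨l - 1, by ring⟩
    rw [blockCyclic_fst, Φ.apply_symm_apply, bigX_single, LinearEquiv.symm_apply_eq]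
    refine (eq_single_of_forall_rho hΓ hΦ hε fun g => ?_).symm
    have h1 := LinearMap.congr_fun (hX g) (Φ.symm (Pi.single (l + 1) v))
    rw [LinearMap.comp_apply, rho_symm_single hΦ, map_smul, character_pow_succ hΓ, mul_smul] at h1
    exact (smul_right_injective U (Units.ne_zero (ε g)) h1).symm
  · refine linearMap_ext_symm_single Φ fun l v => ?_
    rw [blockCyclic_snd_fst, Φ.apply_symm_apply, bigY_single, LinearEquiv.symm_apply_eq]
    refine (eq_single_of_forall_rho hΓ hΦ hε fun g => ?_).symm
    have h1 := LinearMap.congr_fun (hY g) (Φ.symm (Pi.single l v))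
    rw [LinearMap.comp_apply, rho_symm_single hΦ, map_smul] at h1
    change ρ g (Y (Φ.symm (Pi.single l v))) = _ • Y (Φ.symm (Pi.single l v))
    rw [character_pow_succ hΓ, mul_smul, h1, LinearMap.smul_apply, smul_smul,
      mul_inv_cancel₀ (Units.ne_zero _), one_smul]
    rfl
  · ext
    rw [blockCyclic_snd_snd_fst, LinearEquiv.symm_apply_eq, one_smul, bigI_def]
    refine (eq_single_of_forall_rho hΓ hΦ hε fun g => ?_).symm
    have h1 := LinearMap.congr_fun (hi g) 1
    rw [LinearMap.comp_apply, LinearMap.comp_apply, charRep_apply] at h1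
    rw [← h1, mul_one]
    have h2 := i.map_smul ((ε g : ℂ) ^ n.val) 1
    simpa using h2
  · refine linearMap_ext_symm_single Φ fun l v => ?_
    rw [blockCyclic_snd_snd_snd, Φ.apply_symm_apply, bigJ_apply]
    change j (Φ.symm (Pi.single n ((Pi.single l v : ∀ i, V i) n))) = j _
    by_cases h : l = n
    · subst h
      rw [Pi.single_eq_same]
    · rw [Pi.single_eq_of_ne (Ne.symm h), Pi.single_zero, map_zero, map_zero]
      by_contra hne
      refine h (eq_of_forall_character_pow_eq hΓ hε fun g => ?_)
      have h1 := LinearMap.congr_fun (hj g) (Φ.symm (Pi.single l v))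
      rw [LinearMap.comp_apply, LinearMap.comp_apply, rho_symm_single hΦ, map_smul,
        charRep_apply] at h1
      have h2 := mul_right_cancel₀ (Ne.symm hne) h1
      simpa using h2

include hΓ hΦ in
theorem blocks_mem_cyclicSet (hε : Function.Injective ε) {q : Quad U ℂ}
    (hq : q ∈ nakajimaSet ε ρ (charRep (ε ^ n.val)) 1) : blocks Φ n q ∈ cyclicSet V n := by
  rw [← blockCyclic_moment_iff Φ, blockCyclic_blocks hΓ hΦ hε hq]
  have h := hq.2.2.2.2.1
  rwa [map_one] at h

include hΓ hΦ in
-- An equivariant automorphism preserves weight spaces, so it is block-diagonal in the decomposition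
-- `Φ`.
theorem exists_blocks_nakajimaAct (hε : Function.Injective ε) (a : EquivariantAut ρ)
    (q : Quad U ℂ) :
    ∃ a', blocks Φ n (nakajimaAct ρ a q) = cyclicAct a' (blocks Φ n q) := by
  let T : (∀ i, V i) ≃ₗ[ℂ] (∀ i, V i) := Φ.symm ≪≫ₗ a.1 ≪≫ₗ Φ
  have hTs : ∀ l v, T (Pi.single l v) = Pi.single l (T (Pi.single l v) l) := by
    intro l v
    refine eq_single_of_forall_rho (w := a.1 (Φ.symm (Pi.single l v))) hΓ hΦ hε fun g => ?_
    rw [← a.2, rho_symm_single hΦ, map_smul]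
  obtain ⟨a', ha'⟩ := exists_diagonal T fun l u => by
    rw [hTs]
    congr 1
    have hu : u = Pi.single l (u l) + (u - Pi.single l (u l)) := by abel
    have h0 : T (u - Pi.single l (u l)) l = 0 := by
      rw [← Finset.univ_sum_single (u - Pi.single l (u l)), map_sum, Finset.sum_apply]
      refine Finset.sum_eq_zero fun k _ => ?_
      by_cases h : k = l
      · subst h
        simp
      · rw [hTs, Pi.single_eq_of_ne (Ne.symm h)]
    conv_rhs => rw [hu, map_add, Pi.add_apply, h0, add_zero]
  have hTa : ∀ u l, Φ (a.1 u) l = a' l (Φ u l) := by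
    intro u l
    have := congrFun (ha' (Φ u)) l
    simpa [T] using this
  have hs : ∀ l v, a.1.symm (Φ.symm (Pi.single l (a' l v))) = Φ.symm (Pi.single l v) := by
    intro l v
    rw [LinearEquiv.symm_apply_eq, LinearEquiv.symm_apply_eq]
    ext k
    rw [hTa, Φ.apply_symm_apply]
    by_cases h : k = l
    · subst h
      simp
    · simp [h]
  refine ⟨a', eq_cyclicAct_iff.2 ⟨fun l v => ?_, fun l v => ?_, ?_, fun v => ?_⟩⟩
  · change Φ (a.1 (q.1 (a.1.symm (Φ.symm (Pi.single (l + 1) (a' (l + 1) v)))))) l = _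
    rw [hs, hTa]
    rfl
  · change Φ (a.1 (q.2.1 (a.1.symm (Φ.symm (Pi.single l (a' l v)))))) (l + 1) = _
    rw [hs, hTa]
    rfl
  · change Φ (a.1 (q.2.2.1 1)) n = _
    rw [hTa]
    rfl
  · change q.2.2.2 (a.1.symm (Φ.symm (Pi.single n (a' n v)))) = _
    rw [hs]
    rfl

include hΦ in
theorem exists_blockCyclic_cyclicAct (a' : ∀ i, V i ≃ₗ[ℂ] V i) (y : CyclicQuad V n) :
    ∃ a, blockCyclic Φ n (cyclicAct a' y) = nakajimaAct ρ a (blockCyclic Φ n y) := by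
  let T : U ≃ₗ[ℂ] U := Φ ≪≫ₗ LinearEquiv.piCongrRight a' ≪≫ₗ Φ.symm
  have hT : ∀ u, Φ (T u) = fun i => a' i (Φ u i) := by
    intro u
    ext i
    simp [T]
  refine ⟨⟨T, fun g u => ?_⟩, ?_⟩
  · apply Φ.injective
    ext i
    simp only [hT, hΦ, map_smul]
  · have hX := ev_cyclicAct a' y (FreeAlgebra.ι ℂ (Sum.inl true))
    have hY := ev_cyclicAct a' y (FreeAlgebra.ι ℂ (Sum.inl false))
    simp only [ev_X, ev_Y] at hX hY
    refine Prod.ext ?_ (Prod.ext ?_ (Prod.ext ?_ ?_)) <;> refine LinearMap.ext fun u => ?_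
    · obtain ⟨w, rfl⟩ := T.surjective u
      change _ = T ((blockCyclic Φ n y).1 (T.symm (T w)))
      rw [T.symm_apply_apply, blockCyclic_fst, hT, hX, LinearEquiv.symm_apply_eq, hT,
        blockCyclic_fst, Φ.apply_symm_apply]
    · obtain ⟨w, rfl⟩ := T.surjective u
      change _ = T ((blockCyclic Φ n y).2.1 (T.symm (T w)))
      rw [T.symm_apply_apply, blockCyclic_snd_fst, hT, hY, LinearEquiv.symm_apply_eq, hT,
        blockCyclic_snd_fst, Φ.apply_symm_apply]
    · change _ = T ((blockCyclic Φ n y).2.2.1 u)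
      rw [blockCyclic_snd_snd_fst, bigI_cyclicAct, LinearEquiv.symm_apply_eq, hT,
        blockCyclic_snd_snd_fst, Φ.apply_symm_apply]
      ext i
      simp
    · obtain ⟨w, rfl⟩ := T.surjective u
      change _ = (blockCyclic Φ n y).2.2.2 (T.symm (T w))
      rw [T.symm_apply_apply, blockCyclic_snd_snd_snd, hT, bigJ_cyclicAct, blockCyclic_snd_snd_snd]

end Blocks

end

theorem theorem14
    -- the cyclic group `Γ` of order `m` with a primitive character `ε`
    {m : ℕ} [NeZero m] {Γ : Type*} [Group Γ] (hΓ : Nat.card Γ = m)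
    (ε : Γ →* ℂˣ) (hε : Function.Injective ε)
    -- a finite-dimensional `Γ`-module `U` with its decomposition `U ≅ ⨁ V_i ⊗ W_i`, `W_i = ε ^ i`
    {U : Type*} [AddCommGroup U] [Module ℂ U] [FiniteDimensional ℂ U]
    (ρ : Representation ℂ Γ U)
    (V : ZMod m → Type*) [∀ i, AddCommGroup (V i)] [∀ i, Module ℂ (V i)]
    [∀ i, FiniteDimensional ℂ (V i)]
    (Φ : U ≃ₗ[ℂ] ∀ i, V i)
    (hΦ : ∀ (g : Γ) (u : U) (i : ZMod m), Φ (ρ g u) i = ((ε g : ℂ) ^ i.val) • Φ u i)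
    (n : ZMod m) :
    -- `ψ` is an isomorphism with inverse given by block-cyclic matrices
    (∃ (ψ : NakajimaVariety ε ρ (charRep (ε ^ n.val)) 1 → CyclicQuiverVariety V n)
        (χ : CyclicQuiverVariety V n → NakajimaVariety ε ρ (charRep (ε ^ n.val)) 1),
      IsVarietyIso ψ ∧ Function.LeftInverse χ ψ ∧ Function.RightInverse χ ψ ∧
      (∀ x : nakajimaSet ε ρ (charRep (ε ^ n.val)) 1,
        ∃ h : blocks Φ n x.1 ∈ cyclicSet V n,
          ψ (GITQuotient.mk _ _ x) = GITQuotient.mk _ _ ⟨blocks Φ n x.1, h⟩) ∧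
      (∀ y : cyclicSet V n,
        ∃ h : blockCyclic Φ n y.1 ∈ nakajimaSet ε ρ (charRep (ε ^ n.val)) 1,
          χ (GITQuotient.mk _ _ y) = GITQuotient.mk _ _ ⟨blockCyclic Φ n y.1, h⟩)) ∧
    -- the dimension for `m = 2`
    (m = 2 → Nonempty (CyclicQuiverVariety V n) →
      ∃ d : ℕ, topologicalKrullDim (CyclicQuiverVariety V n) = d ∧
        (d : ℤ) = 2 * ((Module.finrank ℂ (V n) : ℤ) -
          ((Module.finrank ℂ (V 0) : ℤ) - (Module.finrank ℂ (V 1) : ℤ)) ^ 2)) ∧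
    -- the dimension for `m > 2`
    (2 < m → Nonempty (CyclicQuiverVariety V n) →
      ∃ d : ℕ, topologicalKrullDim (CyclicQuiverVariety V n) = d ∧
        (d : ℤ) = 2 * ((Module.finrank ℂ (V n) : ℤ) -
          (∑ i : ZMod m, (Module.finrank ℂ (V i) : ℤ) ^ 2 -
            ∑ i : ZMod m, (Module.finrank ℂ (V i) : ℤ) * (Module.finrank ℂ (V (i + 1)) : ℤ)))) := by
  refine ⟨exists_isVarietyIso (isLinearMap_blocks Φ n) (isLinearMap_blockCyclic Φ n)
    (fun x hx => blocks_mem_cyclicSet hΓ hΦ hε hx)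
    (fun y hy => blockCyclic_mem_nakajimaSet hΓ hΦ hy)
    (fun x hx => blockCyclic_blocks hΓ hΦ hε hx) (fun y _ => blocks_blockCyclic Φ n y)
    (exists_blocks_nakajimaAct hΓ hΦ hε) (exists_blockCyclic_cyclicAct hΦ), ?_, ?_⟩
  · rintro rfl hne
    obtain ⟨d, hd, h⟩ := CyclicQuad.exists_topologicalKrullDim_eq V n
    refine ⟨d, hd, ?_⟩
    -- For `m = 2` both neighbours of a vertex coincide, so the product `k_0 k_1` occurs twice in
    -- the cyclic sum and the square is completed.
    have h2 : (1 + 1 : ZMod 2) = 0 := rfl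
    have hs : ∀ f : ZMod 2 → ℕ, ∑ i, f i = f 0 + f 1 := fun f => Fin.sum_univ_two f
    rw [hs, hs, zero_add, h2] at h
    zify at h
    linear_combination h
  · intro _ hne
    obtain ⟨d, hd, h⟩ := CyclicQuad.exists_topologicalKrullDim_eq V n
    refine ⟨d, hd, ?_⟩
    zify at h
    linear_combination h
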